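/- Let $n\ge 3$, $l>0$, $c>0$, and let $\gamma:(0,l)\to(0,\infty)$ be a smooth function such that $\lim_{s\to 0}\gamma(s)=0$ and $\lim_{s\to l}\gamma(s)$ exists and is a positive real number. Put $$\lambda(s):=c\int_s^l\gamma(t)\,dt,\qquad s\in(0,l).$$ View $S^n\subset\mathbb{R}^{n-1}\oplus\mathbb{R}^2$ as the join of the unit spheres $S^{n-2}\subset\mathbb{R}^{n-1}$ and $S^1\subset\mathbb{R}^2$ through the map $(s,x,\theta)\mapsto\left(\sin\left(\tfrac{\pi s}{2l}\right)x,\ \cos\left(\tfrac{\pi s}{2l}\right)\theta\right)$, which collapses the factor $S^{n-2}$ over $s=0$ and the factor $S^1$ over $s=l$, and which identifies $(0,l)\times S^{n-2}\times S^1$ with an open dense subset of $S^n$. Let $g_{S^{n-2}}$ be the round metric of the unit sphere and $d\theta^2$ the metric of the unit circle. Then the Riemannian metric $$g=ds^2+\gamma^2(s)\,g_{S^{n-2}}+\lambda^2(s)\,d\theta^2$$ on $(0,l)\times S^{n-2}\times S^1$ extends to a smooth Riemannian metric on $S^n$ if and only if there exist $\varepsilon\in(0,\min(1,l)]$ and smooth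 functions $a,b:(-\varepsilon,\varepsilon)\to\mathbb{R}$ such that $$\gamma(t)=t\bigl(1+t^2a(t^2)\bigr)\quad\text{and}\quad\gamma(l-t)=\frac1c+t^2\,b(t^2)\qquad\text{for all }t\in(0,\varepsilon).$$ -/

import Mathlib

open Set Filter Topology MeasureTheory
open scoped Manifold ContDiff

noncomputable section

namespace RiemannianJoin

/-- Euclidean space `ℝᵏ`. -/
abbrev Euc (k : ℕ) : Type := EuclideanSpace ℝ (Fin k)

/-- The unit sphere `Sᵏ` in `ℝᵏ⁺¹`. -/
abbrev Sph (k : ℕ) : Type := Metric.sphere (0 : Euc (k + 1)) 1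

/-- The orthogonal direct sum `ℝᵐ⁺¹ ⊕ ℝ²`, a Euclidean space of dimension `m + 3`. -/
abbrev JoinSpace (m : ℕ) : Type := WithLp 2 (Euc (m + 1) × Euc 2)

/-- The unit sphere `Sᵐ⁺²` in `ℝᵐ⁺¹ ⊕ ℝ²`, with its standard smooth structure. -/
abbrev JoinSph (m : ℕ) : Type := Metric.sphere (0 : JoinSpace m) 1

instance finrank_joinSpace (m : ℕ) :
    Fact (Module.finrank ℝ (JoinSpace m) = (m + 2) + 1) := by
  constructor
  rw [LinearEquiv.finrank_eq (WithLp.linearEquiv 2 ℝ (Euc (m + 1) × Euc 2)),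
    Module.finrank_prod, finrank_euclideanSpace_fin, finrank_euclideanSpace_fin]

/-- The round metric `g_{Sᵏ}` at `x`: the Euclidean inner product restricted to the tangent space
of the unit sphere, that is, pulled back by the inclusion `Sᵏ → ℝᵏ⁺¹`. For `k = 1` this is the
metric `dθ²` of the unit circle, of total length `2π`. -/
def roundMetric {k : ℕ} (x : Sph k) (u v : TangentSpace (𝓡 k) x) : ℝ :=
  inner ℝ (E := Euc (k + 1))
    (mfderiv (𝓡 k) 𝓘(ℝ, Euc (k + 1)) (fun y : Sph k => (y : Euc (k + 1))) x u)
    (mfderiv (𝓡 k) 𝓘(ℝ, Euc (k + 1)) (fun y : Sph k => (y : Euc (k + 1))) x v)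

/-- The product model for the manifold `ℝ × Sᵐ × S¹`. -/
abbrev cylModel (m : ℕ) := 𝓘(ℝ, ℝ).prod ((𝓡 m).prod (𝓡 1))

/-- The doubly warped metric `ds² + γ(s)² g_{Sᵐ} + Λ(s)² dθ²` at the point `p = (s, x, θ)`. -/
def joinMetric {m : ℕ} (γ Λ : ℝ → ℝ) (p : ℝ × Sph m × Sph 1)
    (u v : TangentSpace (cylModel m) p) : ℝ :=
  (u.1 : ℝ) * (v.1 : ℝ) + γ p.1 ^ 2 * roundMetric p.2.1 u.2.1 v.2.1
    + Λ p.1 ^ 2 * roundMetric p.2.2 u.2.2 v.2.2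

theorem joinMap_mem {m : ℕ} (l : ℝ) (p : ℝ × Sph m × Sph 1) :
    (WithLp.toLp 2 (Real.sin (Real.pi * p.1 / (2 * l)) • (p.2.1 : Euc (m + 1)),
      Real.cos (Real.pi * p.1 / (2 * l)) • (p.2.2 : Euc 2)) : JoinSpace m)
      ∈ Metric.sphere (0 : JoinSpace m) 1 := by
  have h1 : ‖(p.2.1 : Euc (m + 1))‖ = 1 := by simp
  have h2 : ‖(p.2.2 : Euc 2)‖ = 1 := by simp
  rw [mem_sphere_zero_iff_norm, ← sq_eq_sq₀ (norm_nonneg _) zero_le_one,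
    WithLp.prod_norm_sq_eq_of_L2]
  simp [norm_smul, h1, h2]

/-- The parametrization of `Sᵐ⁺²` as the join of `Sᵐ` and `S¹` over the interval `[0, l]`:
`(s, x, θ) ↦ (sin(πs/2l) x, cos(πs/2l) θ)`. On `[0, l] × Sᵐ × S¹` it is onto and collapses
exactly the factor `Sᵐ` over `s = 0` and the factor `S¹` over `s = l`; on `(0, l) × Sᵐ × S¹`
it is a diffeomorphism onto an open dense subset. Since `sin(πs/2l)` is an odd smooth function of
`s` with nonzero derivative at `0`, and likewise `cos(πs/2l)` in `l - s`, the smooth structure of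
`Sᵐ⁺²` at the two collapsed ends is that of polar coordinates `(s, x)`, resp. `(l - s, θ)`. -/
def joinMap {m : ℕ} (l : ℝ) (p : ℝ × Sph m × Sph 1) : JoinSph m :=
  ⟨WithLp.toLp 2 (Real.sin (Real.pi * p.1 / (2 * l)) • (p.2.1 : Euc (m + 1)),
    Real.cos (Real.pi * p.1 / (2 * l)) • (p.2.2 : Euc 2)), joinMap_mem l p⟩

/-- The metric `ds² + γ² g_{Sᵐ} + Λ² dθ²`, given on the open submanifold `(0, l) × Sᵐ × S¹` of
the join `Sᵐ⁺²`, extends to a smooth Riemannian metric on `Sᵐ⁺²`. -/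
def ExtendsSmoothly (m : ℕ) (l : ℝ) (γ Λ : ℝ → ℝ) : Prop :=
  ∃ G : Bundle.ContMDiffRiemannianMetric (𝓡 (m + 2)) ∞ (Euc (m + 2))
      (fun q : JoinSph m => TangentSpace (𝓡 (m + 2)) q),
    ∀ p : ℝ × Sph m × Sph 1, p.1 ∈ Ioo 0 l →
      ∀ u v : TangentSpace (cylModel m) p,
        G.inner (joinMap l p)
          (mfderiv (cylModel m) (𝓡 (m + 2)) (joinMap l) p u)
          (mfderiv (cylModel m) (𝓡 (m + 2)) (joinMap l) p v) = joinMetric γ Λ p u v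

/-- The warping function `s ↦ c ∫ₛˡ γ(t) dt`. -/
def warp (c l : ℝ) (γ : ℝ → ℝ) (s : ℝ) : ℝ := c * ∫ t in s..l, γ t

end RiemannianJoin

end

namespace RiemannianJoin

/-! Put k = π/(2l), X = sin(ks) x, Θ = cos(ks) θ and y = |X|² = sin²(ks). The metric extends exactly
when γ is odd at 0 with slope 1 and even about l with value 1/c; Whitney's theorem on even functions
turns these parities into the functions a and b.

Necessity: along a meridian, the constant ambient vectors (w, 0) and (0, w') have smooth squared
lengths H and K, with γ² = sin²(ks) H and λ² = cos²(ks) K. Past a collapsed end the meridian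
continues with x or θ replaced by its antipode, and γ does not depend on these, so H is even about 0
and about l. Unit speed of meridians at the two ends gives k² H(0) = 1 and k² K(l) = 1. Hence γ =
sin(ks) √H has the right parities and slope, and (c γ(l))² = λ'(l)² = k² K(l) = 1. This is
`exists_smooth_extension_data` followed by `exists_even_expansions_of_extension_data`.

Sufficiency: on the cylinder the ambient form A(y)|dX|² + C(y)|dΘ|² + D(y)(X·dX)² equals g as soon
as γ² = yA, λ² = (1-y)C and 1 - k²(1-y)A - k²yC = k²y(1-y)D. Integrating γ makes λ even at 0 and odd
about l with slope -1, so γ²/sin² and λ²/cos² extend evenly over both ends and are smooth functions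
A, C of y. Since A(0) = C(1) = 1/k², the left side of the last equation vanishes at y = 0 and y = 1,
and Hadamard's lemma yields D (`exists_metric_profiles`). Positivity on tangent vectors is
Cauchy–Schwarz (`joinForm_pos`). -/

/-! ### Hadamard's lemma in one variable -/

theorem hasDerivAt_integral_pow_mul_comp {f : ℝ → ℝ} (hf : ContDiff ℝ 1 f) (k : ℕ) (x : ℝ) :
    HasDerivAt (fun t => ∫ s in (0 : ℝ)..1, s ^ k * f (t * s))
      (∫ s in (0 : ℝ)..1, s ^ (k + 1) * deriv f (x * s)) x := by
  have hd : Continuous (deriv f) := hf.continuous_deriv le_rfl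
  obtain ⟨C, hC⟩ := (isCompact_Icc : IsCompact (Icc (-(|x| + 1)) (|x| + 1))).exists_bound_of_continuousOn
    hd.continuousOn
  refine (intervalIntegral.hasDerivAt_integral_of_dominated_loc_of_deriv_le
    (F' := fun t s => s ^ (k + 1) * deriv f (t * s)) (bound := fun _ => C)
    (Metric.ball_mem_nhds x one_pos) (Eventually.of_forall fun t => ?_) ?_ ?_ ?_ ?_ ?_).2
  · have := hf.continuous
    exact (by fun_prop : Continuous fun s => s ^ k * f (t * s)).aestronglyMeasurable
  · have := hf.continuous
    exact (by fun_prop : Continuous fun s => s ^ k * f (x * s)).intervalIntegrable _ _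
  · exact (by fun_prop : Continuous fun s => s ^ (k + 1) * deriv f (x * s)).aestronglyMeasurable
  · refine Eventually.of_forall fun s hs t ht => ?_
    rw [uIoc_of_le zero_le_one] at hs
    rw [Metric.mem_ball, Real.dist_eq] at ht
    have h1 : |t| ≤ |x| + 1 := by
      have := abs_sub_abs_le_abs_sub t x
      linarith
    have h2 : |t * s| ≤ |x| + 1 := by
      rw [abs_mul, abs_of_pos hs.1]
      nlinarith [abs_nonneg t, hs.2]
    have h3 := hC (t * s) (abs_le.1 h2)
    rw [norm_mul]
    have h4 : ‖s ^ (k + 1)‖ ≤ 1 := by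
      rw [Real.norm_of_nonneg (pow_nonneg hs.1.le _)]
      exact pow_le_one₀ hs.1.le hs.2
    nlinarith [norm_nonneg (deriv f (t * s)), norm_nonneg (s ^ (k + 1))]
  · exact continuous_const.intervalIntegrable _ _
  · refine Eventually.of_forall fun s _ t _ => ?_
    have h1 : HasDerivAt f (deriv f (t * s)) (t * s) :=
      (hf.differentiable one_ne_zero _).hasDerivAt
    have h2 := (h1.comp t ((hasDerivAt_id t).mul_const s)).const_mul (s ^ k)
    refine h2.congr_deriv ?_
    simp only [pow_succ]
    ring

/-- Differentiating under the integral brings down a factor s. The weight s^k makes the family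
closed under this operation, (f, k) becoming (f', k + 1), so the induction runs over all f and k at
once. -/
theorem contDiff_integral_pow_mul_comp {f : ℝ → ℝ} (hf : ContDiff ℝ ∞ f) (k : ℕ) :
    ContDiff ℝ ∞ (fun t => ∫ s in (0 : ℝ)..1, s ^ k * f (t * s)) := by
  rw [contDiff_infty]
  intro n
  induction n generalizing f k with
  | zero =>
    refine contDiff_zero.2 (continuous_iff_continuousAt.2 fun x => ?_)
    exact (hasDerivAt_integral_pow_mul_comp (hf.of_le (mod_cast le_top)) k x).continuousAt
  | succ n ih =>
    have h := fun x => hasDerivAt_integral_pow_mul_comp (hf.of_le (mod_cast le_top)) k x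
    rw [Nat.cast_succ, contDiff_succ_iff_deriv]
    refine ⟨fun x => (h x).differentiableAt, by simp, ?_⟩
    rw [funext fun x => (h x).deriv]
    exact ih (contDiff_infty_iff_deriv.1 hf).2 (k + 1)

/-- Hadamard's lemma in one variable. -/
theorem exists_contDiff_eq_add_mul {f : ℝ → ℝ} (hf : ContDiff ℝ ∞ f) :
    ∃ g : ℝ → ℝ, ContDiff ℝ ∞ g ∧ ∀ t, f t = f 0 + t * g t := by
  have hd := (contDiff_infty_iff_deriv.1 hf).2
  refine ⟨_, contDiff_integral_pow_mul_comp hd 0, fun t => ?_⟩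
  have h := intervalIntegral.integral_eq_sub_of_hasDerivAt (a := 0) (b := 1)
    (f := fun s => f (t * s)) (f' := fun s => t * deriv f (t * s)) (fun s _ => by
      have h1 : HasDerivAt f (deriv f (t * s)) (t * s) :=
        (hf.differentiable (by simp) _).hasDerivAt
      refine (h1.comp s ((hasDerivAt_id s).const_mul t)).congr_deriv ?_
      ring) (by
      have := hd.continuous
      exact (by fun_prop : Continuous fun s => t * deriv f (t * s)).intervalIntegrable _ _)
  rw [intervalIntegral.integral_const_mul] at h
  simp only [mul_one, mul_zero] at h
  simp only [pow_zero, one_mul]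
  rw [h]; ring

/-- The derivative is odd, so it vanishes at 0 and Hadamard's lemma divides it by t. If f(t) =
φ(t²), the quotient is φ'(t²): this is differentiation in the variable t². -/
theorem exists_even_contDiff_deriv_eq {f : ℝ → ℝ} (hf : ContDiff ℝ ∞ f) (he : ∀ t, f (-t) = f t) :
    ∃ g : ℝ → ℝ, ContDiff ℝ ∞ g ∧ (∀ t, g (-t) = g t) ∧ ∀ t, deriv f t = 2 * t * g t := by
  have hd := (contDiff_infty_iff_deriv.1 hf).2
  have ho : ∀ t, deriv f (-t) = -deriv f t := by
    intro t
    have h := deriv_comp_neg f t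
    simp only [he] at h
    linarith
  have h0 : deriv f 0 = 0 := by
    have := ho 0
    rw [neg_zero] at this
    linarith
  obtain ⟨g, hg, hfg⟩ := exists_contDiff_eq_add_mul hd
  rw [h0] at hfg
  refine ⟨fun t => g t / 2, hg.div_const 2, fun t => ?_, fun t => ?_⟩
  · rcases eq_or_ne t 0 with rfl | ht
    · simp
    · have h1 := hfg (-t)
      rw [ho, hfg t] at h1
      have : g (-t) = g t := mul_left_cancel₀ ht (by linarith)
      simp only [this]
  · rw [hfg t]; ring

/-! ### Borel's lemma -/

/-- A cut-off monomial ψ is rescaled to ψ(Mx)/Mⁿ. The germ at 0 is unchanged, while the k-th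
derivative gains the factor M^(k-n), at most 1/M for k < n. -/
theorem exists_monomial_with_small_derivatives (n : ℕ) (c : ℝ) :
    ∃ f : ℝ → ℝ, ContDiff ℝ ∞ f ∧ (f =ᶠ[𝓝 0] fun x => c * x ^ n) ∧
      (∀ k, ∃ C, ∀ x, ‖iteratedDeriv k f x‖ ≤ C) ∧
      ∀ k < n, ∀ x, ‖iteratedDeriv k f x‖ ≤ (1 / 2) ^ n := by
  let φ : ContDiffBump (0 : ℝ) := ⟨1, 2, one_pos, one_lt_two⟩
  let ψ : ℝ → ℝ := fun x => c * x ^ n * φ x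
  have hψ : ContDiff ℝ ∞ ψ := by
    have := φ.contDiff (n := ⊤)
    exact ((contDiff_const.mul (contDiff_id.pow n))).mul this
  have hψc : HasCompactSupport ψ := φ.hasCompactSupport.mul_left
  have hb : ∀ k, ∃ C, ∀ x, ‖iteratedDeriv k ψ x‖ ≤ C := fun k =>
    (show HasCompactSupport (iteratedDeriv k ψ) by
      rw [iteratedDeriv_eq_equiv_comp]
      exact (hψc.iteratedFDeriv k).comp_left (by simp)).exists_bound_of_continuous
      (hψ.continuous_iteratedDeriv k (mod_cast le_top))
  choose C hC using hb
  have hC0 : ∀ k, 0 ≤ C k := fun k => (norm_nonneg _).trans (hC k 0)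
  -- The sum makes M at least 2ⁿ C k for every k < n; the summand 1 gives M ≥ 1, hence M^(k+1) ≤ Mⁿ.
  let M : ℝ := 1 + 2 ^ n * ∑ k ∈ Finset.range n, C k
  have hM1 : 1 ≤ M := by
    have : 0 ≤ ∑ k ∈ Finset.range n, C k := Finset.sum_nonneg fun k _ => hC0 k
    have : 0 ≤ 2 ^ n * ∑ k ∈ Finset.range n, C k := by positivity
    simp only [M]; linarith
  have hM0 : 0 < M := by linarith
  have hscaled : ContDiff ℝ ∞ fun x => ψ (M * x) := hψ.comp (contDiff_const.mul contDiff_id)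
  have hder : ∀ k x, iteratedDeriv k (fun x => (M ^ n)⁻¹ * ψ (M * x)) x
      = (M ^ n)⁻¹ * (M ^ k * iteratedDeriv k ψ (M * x)) := by
    intro k x
    rw [iteratedDeriv_const_mul_field,
      iteratedDeriv_comp_const_mul (hψ.of_le (mod_cast le_top)) M]
  refine ⟨fun x => (M ^ n)⁻¹ * ψ (M * x), contDiff_const.mul hscaled, ?_, fun k => ?_, ?_⟩
  · have h1 : ∀ᶠ x in 𝓝 (0 : ℝ), φ x = 1 := φ.eventuallyEq_one
    have h2 : Tendsto (fun x : ℝ => M * x) (𝓝 0) (𝓝 0) := by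
      have : Continuous fun x : ℝ => M * x := by fun_prop
      simpa using this.tendsto 0
    filter_upwards [h2.eventually h1] with x hx
    simp only [ψ, hx]
    rw [mul_pow]
    field_simp
  · refine ⟨(M ^ n)⁻¹ * (M ^ k * C k), fun x => ?_⟩
    rw [hder, norm_mul, norm_mul, Real.norm_of_nonneg (by positivity : 0 ≤ (M ^ n)⁻¹),
      Real.norm_of_nonneg (by positivity : 0 ≤ M ^ k)]
    gcongr
    exact hC k _
  · intro k hk x
    rw [hder, norm_mul, norm_mul, Real.norm_of_nonneg (by positivity : 0 ≤ (M ^ n)⁻¹),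
      Real.norm_of_nonneg (by positivity : 0 ≤ M ^ k)]
    have h1 : 2 ^ n * C k ≤ M := by
      have : C k ≤ ∑ k ∈ Finset.range n, C k :=
        Finset.single_le_sum (fun i _ => hC0 i) (Finset.mem_range.2 hk)
      have : 2 ^ n * C k ≤ 2 ^ n * ∑ k ∈ Finset.range n, C k := by gcongr
      simp only [M]; linarith
    have h2 : M ^ k * M ≤ M ^ n := by
      rw [← pow_succ]
      exact pow_le_pow_right₀ hM1 hk
    have h3 : ‖iteratedDeriv k ψ (M * x)‖ ≤ C k := hC k _
    rw [inv_mul_le_iff₀ (by positivity), one_div, inv_pow, ← div_eq_mul_inv,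
      le_div_iff₀ (by positivity)]
    calc M ^ k * ‖iteratedDeriv k ψ (M * x)‖ * 2 ^ n ≤ M ^ k * (2 ^ n * C k) := by
          rw [mul_assoc, mul_comm _ ((2 : ℝ) ^ n)]; gcongr
      _ ≤ M ^ k * M := by gcongr
      _ ≤ M ^ n := h2

/-- Borel's lemma: every sequence of reals is the sequence of derivatives at `0` of a smooth
function. -/
theorem exists_contDiff_iteratedDeriv_eq (c : ℕ → ℝ) :
    ∃ h : ℝ → ℝ, ContDiff ℝ ∞ h ∧ ∀ n, iteratedDeriv n h 0 = c n := by
  choose f hf hf0 hfb hfs using fun n =>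
    exists_monomial_with_small_derivatives n (c n / n.factorial)
  choose C hC using hfb
  -- For the k-th derivative only the finitely many terms with n ≤ k lack the geometric bound.
  let v : ℕ → ℕ → ℝ := fun k n => if k < n then (1 / 2) ^ n else C n k
  have hv : ∀ k, Summable (v k) := by
    intro k
    refine (summable_geometric_two).congr_cofinite ?_
    rw [Nat.cofinite_eq_atTop]
    filter_upwards [eventually_gt_atTop k] with n hn
    simp [v, hn]
  have hbound : ∀ (k n : ℕ) (x : ℝ), ‖iteratedFDeriv ℝ k (f n) x‖ ≤ v k n := by
    intro k n x
    rw [norm_iteratedFDeriv_eq_norm_iteratedDeriv]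
    simp only [v]
    split_ifs with hkn
    · exact hfs n k hkn x
    · exact hC n k x
  refine ⟨fun x => ∑' n, f n x, contDiff_tsum (N := ⊤) hf (fun k _ => hv k)
    (fun k n x _ => hbound k n x), fun k => ?_⟩
  rw [iteratedDeriv_eq_iteratedFDeriv,
    iteratedFDeriv_tsum_apply (N := ⊤) hf (fun k _ => hv k) (fun k n x _ => hbound k n x) le_top]
  have hsum : Summable fun n => iteratedFDeriv ℝ k (f n) 0 :=
    .of_norm_bounded (hv k) fun n => hbound k n 0
  have happ : (∑' n, iteratedFDeriv ℝ k (f n) 0) (fun _ => (1 : ℝ))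
      = ∑' n, iteratedFDeriv ℝ k (f n) 0 (fun _ => (1 : ℝ)) :=
    (ContinuousMultilinearMap.apply ℝ (fun _ : Fin k => ℝ) ℝ fun _ => 1).map_tsum hsum
  rw [happ]
  have hterm : ∀ n, iteratedFDeriv ℝ k (f n) 0 (fun _ => (1 : ℝ)) = if n = k then c k else 0 := by
    intro n
    rw [← iteratedDeriv_eq_iteratedFDeriv, (hf0 n).iteratedDeriv_eq,
      iteratedDeriv_const_mul_field]
    have hp : iteratedDeriv k (fun x : ℝ => x ^ n) 0 = (n.descFactorial k : ℝ) * 0 ^ (n - k) := by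
      rw [iteratedDeriv_pow]
    rw [hp]
    rcases lt_trichotomy n k with h | rfl | h
    · simp [Nat.descFactorial_eq_zero_iff_lt.2 h, h.ne]
    · simp [Nat.descFactorial_self, Nat.factorial_ne_zero]
    · have : n - k ≠ 0 := by omega
      simp [this, h.ne']
  simp only [hterm, tsum_ite_eq]

/-! ### Whitney's theorem on even functions -/

/-- Whitney's theorem on even functions: a smooth even function of `t` is a smooth function
of `t²`. -/
theorem exists_contDiff_comp_sq {f : ℝ → ℝ} (hf : ContDiff ℝ ∞ f) (he : ∀ t, f (-t) = f t) :
    ∃ g : ℝ → ℝ, ContDiff ℝ ∞ g ∧ ∀ t, f t = g (t ^ 2) := by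
  let S := {f : ℝ → ℝ // ContDiff ℝ ∞ f ∧ ∀ t, f (-t) = f t}
  have hstep : ∀ f : S, ∃ g : S, ∀ t, deriv f.1 t = 2 * t * g.1 t := fun f => by
    obtain ⟨g, hg, hge, hfg⟩ := exists_even_contDiff_deriv_eq f.2.1 f.2.2
    exact ⟨⟨g, hg, hge⟩, hfg⟩
  choose step hstep using hstep
  -- If f(t) = g(t²), then `F n` must be t ↦ g⁽ⁿ⁾(t²).
  let F : ℕ → S := fun n => step^[n] ⟨f, hf, he⟩
  have hF : ∀ n t, deriv (F n).1 t = 2 * t * (F (n + 1)).1 t := by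
    intro n t
    simp only [F, Function.iterate_succ_apply']
    exact hstep _ t
  obtain ⟨h, hh, hh0⟩ := exists_contDiff_iteratedDeriv_eq fun n => (F n).1 0
  -- `G n` is the intended n-th derivative of g: forced for u ≥ 0, and borrowed for u < 0 from a
  -- Borel function h with matching derivatives at 0.
  let G : ℕ → ℝ → ℝ := fun n u => if 0 ≤ u then (F n).1 (√u) else iteratedDeriv n h u
  have hGc : ∀ n, Continuous (G n) := by
    intro n
    refine Continuous.if_le ?_ ?_ continuous_const continuous_id ?_
    · exact (F n).2.1.continuous.comp Real.continuous_sqrt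
    · exact hh.continuous_iteratedDeriv n (mod_cast le_top)
    · rintro x rfl
      simp [hh0]
  have hGd : ∀ n u, HasDerivAt (G n) (G (n + 1) u) u := by
    intro n
    -- At 0 the square root is not differentiable; the derivative there is the limit of the
    -- derivatives nearby.
    refine hasDerivAt_of_hasDerivAt_of_ne' (x := 0) (fun u hu => ?_) (hGc n).continuousAt
      (hGc (n + 1)).continuousAt
    rcases lt_or_gt_of_ne hu with hu | hu
    · have h1 : G n =ᶠ[𝓝 u] iteratedDeriv n h := by
        filter_upwards [Iio_mem_nhds hu] with x hx
        simp [G, not_le.2 (mem_Iio.1 hx)]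
      refine HasDerivAt.congr_of_eventuallyEq ?_ h1
      simp only [G, not_le.2 hu, if_false]
      rw [iteratedDeriv_succ]
      exact ((hh.differentiable_iteratedDeriv n (mod_cast WithTop.coe_lt_top _)) u).hasDerivAt
    · have h1 : G n =ᶠ[𝓝 u] fun x => (F n).1 (√x) := by
        filter_upwards [Ioi_mem_nhds hu] with x hx
        simp [G, (le_of_lt hx : (0 : ℝ) ≤ x)]
      refine HasDerivAt.congr_of_eventuallyEq ?_ h1
      simp only [G, hu.le, if_true]
      have h2 : HasDerivAt (F n).1 (deriv (F n).1 (√u)) (√u) :=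
        ((F n).2.1.differentiable (by simp) _).hasDerivAt
      refine (h2.comp u (Real.hasDerivAt_sqrt hu.ne')).congr_deriv ?_
      rw [hF]
      have : √u ≠ 0 := (Real.sqrt_pos.2 hu).ne'
      field_simp
  refine ⟨G 0, ?_, fun t => ?_⟩
  · rw [contDiff_infty]
    intro n
    generalize 0 = k
    induction n generalizing k with
    | zero => exact contDiff_zero.2 (hGc k)
    | succ n ih =>
      rw [Nat.cast_succ, contDiff_succ_iff_deriv]
      refine ⟨fun x => (hGd k x).differentiableAt, by simp, ?_⟩
      rw [funext fun x => (hGd k x).deriv]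
      exact ih (k + 1)
  · have h1 : (F 0).1 = f := rfl
    simp only [G, sq_nonneg, if_true, Real.sqrt_sq_eq_abs, h1]
    rcases abs_choice t with h | h <;> simp [h, he]

/-- A function that is smooth near `0` coincides near `0` with a smooth function that is even if
the given function is. -/
theorem exists_contDiff_eq_near_zero {f : ℝ → ℝ} {δ : ℝ} (hδ : 0 < δ)
    (hf : ContDiffOn ℝ ∞ f (Ioo (-δ) δ)) :
    ∃ g : ℝ → ℝ, ContDiff ℝ ∞ g ∧ ((∀ t ∈ Ioo (-δ) δ, f (-t) = f t) → ∀ t, g (-t) = g t) ∧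
      ∀ t ∈ Ioo (-(δ / 4)) (δ / 4), f t = g t := by
  let φ : ContDiffBump (0 : ℝ) := ⟨δ / 4, δ / 2, by positivity, by linarith⟩
  refine ⟨fun t => φ t * f t, ?_, fun he t => ?_, fun t ht => ?_⟩
  · rw [contDiff_iff_contDiffAt]
    intro t
    by_cases ht : t ∈ Ioo (-δ) δ
    · exact φ.contDiff.contDiffAt.mul (hf.contDiffAt (isOpen_Ioo.mem_nhds ht))
    · have h1 : t ∉ tsupport φ := by
        rw [φ.tsupport_eq, Metric.mem_closedBall, dist_zero_right, Real.norm_eq_abs, not_le]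
        rw [mem_Ioo, ← abs_lt, not_lt] at ht
        exact lt_of_lt_of_le (by simp only [φ]; linarith) ht
      refine (contDiffAt_const (c := (0 : ℝ))).congr_of_eventuallyEq ?_
      filter_upwards [notMem_tsupport_iff_eventuallyEq.1 h1] with x hx
      simp only [hx, Pi.zero_apply, zero_mul]
  · by_cases ht : t ∈ Ioo (-δ) δ
    · simp only [φ.neg, he t ht]
    · have h1 : φ t = 0 := by
        apply φ.zero_of_le_dist
        rw [dist_zero_right, Real.norm_eq_abs]
        rw [mem_Ioo, ← abs_lt, not_lt] at ht
        exact le_trans (by simp only [φ]; linarith) ht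
      simp only [φ.neg, h1, zero_mul]
  · have : φ t = 1 := by
      apply φ.one_of_mem_closedBall
      rw [Metric.mem_closedBall, dist_zero_right, Real.norm_eq_abs]
      exact (abs_lt.2 ht).le
    simp [this]

theorem exists_contDiff_comp_sq_near_zero {f : ℝ → ℝ} {δ : ℝ} (hδ : 0 < δ)
    (hf : ContDiffOn ℝ ∞ f (Ioo (-δ) δ)) (he : ∀ t ∈ Ioo (-δ) δ, f (-t) = f t) :
    ∃ g : ℝ → ℝ, ContDiff ℝ ∞ g ∧ ∀ t ∈ Ioo (-(δ / 4)) (δ / 4), f t = g (t ^ 2) := by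
  obtain ⟨F, hF, hFe, hfF⟩ := exists_contDiff_eq_near_zero hδ hf
  obtain ⟨g, hg, hFg⟩ := exists_contDiff_comp_sq hF (hFe he)
  exact ⟨g, hg, fun t ht => (hfF t ht).trans (hFg t)⟩

/-! ### Riemannian metrics on a unit sphere induced by ambient bilinear forms -/

theorem contDiff_flip {X Y : Type*} [NormedAddCommGroup X] [NormedSpace ℝ X]
    [NormedAddCommGroup Y] [NormedSpace ℝ Y] :
    ContDiff ℝ ∞ (fun f : X →L[ℝ] Y →L[ℝ] ℝ => f.flip) := by
  have h : IsLinearMap ℝ (fun f : X →L[ℝ] Y →L[ℝ] ℝ => f.flip) :=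
    ⟨fun _ _ => rfl, fun _ _ => rfl⟩
  exact (h.with_bound 1 fun f => by rw [f.opNorm_flip, one_mul]).contDiff

/-- By compactness of the unit sphere, g v v ≥ δ‖v‖² for some δ > 0. Boundedness of the unit balls
is part of the data of a `Bundle.ContMDiffRiemannianMetric`. -/
theorem isVonNBounded_sublevel {X : Type*} [NormedAddCommGroup X] [NormedSpace ℝ X]
    [FiniteDimensional ℝ X] (g : X →L[ℝ] X →L[ℝ] ℝ) (hg : ∀ v, v ≠ 0 → 0 < g v v) :
    Bornology.IsVonNBounded ℝ {v : X | g v v < 1} := by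
  have hcont : Continuous fun v => g v v := by fun_prop
  obtain ⟨δ, hδ, hmin⟩ : ∃ δ > 0, ∀ v : X, ‖v‖ = 1 → δ ≤ g v v := by
    rcases (Metric.sphere (0 : X) 1).eq_empty_or_nonempty with h | h
    · exact ⟨1, one_pos, fun v hv => by
        have : v ∈ Metric.sphere (0 : X) 1 := by simpa using hv
        simp [h] at this⟩
    · obtain ⟨v₀, hv₀, hv⟩ := (isCompact_sphere (0 : X) 1).exists_isMinOn h hcont.continuousOn
      refine ⟨g v₀ v₀, hg _ fun h0 => ?_, fun v hv1 => hv (by simpa using hv1)⟩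
      simp [h0] at hv₀
  rw [NormedSpace.isVonNBounded_iff' ]
  refine ⟨√(1 / δ), fun v hv => ?_⟩
  rcases eq_or_ne v 0 with rfl | h0
  · simp
  · have hn : 0 < ‖v‖ := norm_pos_iff.2 h0
    have h1 := hmin (‖v‖⁻¹ • v) (by rw [norm_smul, norm_inv, norm_norm, inv_mul_cancel₀ hn.ne'])
    simp only [map_smul, smul_apply, smul_eq_mul] at h1
    have hv' : g v v < 1 := hv
    apply Real.le_sqrt_of_sq_le
    rw [le_div_iff₀ hδ]
    have h2 : ‖v‖⁻¹ * (‖v‖⁻¹ * g v v) = g v v / ‖v‖ ^ 2 := by field_simp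
    rw [h2, le_div_iff₀ (by positivity)] at h1
    linarith

section Sphere

variable {E : Type*} [NormedAddCommGroup E] [InnerProductSpace ℝ E] {n : ℕ}
  [Fact (Module.finrank ℝ E = n + 1)]

/-- The differential of the inclusion of the unit sphere. -/
noncomputable def sphereIncl (q : Metric.sphere (0 : E) 1) :
    EuclideanSpace ℝ (Fin n) →L[ℝ] E :=
  mfderiv (𝓡 n) 𝓘(ℝ, E) ((↑) : Metric.sphere (0 : E) 1 → E) q

theorem sphereIncl_injective (q : Metric.sphere (0 : E) 1) :
    Function.Injective (sphereIncl (n := n) q) :=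
  injective_mvfderiv_subtypeVal_sphere q

theorem exists_sphereIncl_eq_iff (q : Metric.sphere (0 : E) 1) (w : E) :
    (∃ u, sphereIncl (n := n) q u = w) ↔ inner ℝ (q : E) w = 0 := by
  have h := range_mvfderiv_subtypeVal (n := n) q
  have h1 : (∃ u, sphereIncl (n := n) q u = w) ↔
      w ∈ (mvfderiv (𝓡 n) ((↑) : Metric.sphere (0 : E) 1 → E) q).range := Iff.rfl
  rw [h1, h, Submodule.mem_orthogonal_singleton_iff_inner_right]

theorem inner_sphereIncl (q : Metric.sphere (0 : E) 1) (u : EuclideanSpace ℝ (Fin n)) :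
    inner ℝ (q : E) (sphereIncl q u) = 0 :=
  (exists_sphereIncl_eq_iff q _).1 ⟨u, rfl⟩

/-- In tangent coordinates around a point the differential of the inclusion is a smooth family of
linear maps between fixed spaces, and g is B composed with it in both slots. -/
theorem contMDiff_of_eq_pullback {B : Metric.sphere (0 : E) 1 → E →L[ℝ] E →L[ℝ] ℝ}
    (hB : ContMDiff (𝓡 n) 𝓘(ℝ, E →L[ℝ] E →L[ℝ] ℝ) ∞ B)
    (g : ∀ q : Metric.sphere (0 : E) 1, TangentSpace (𝓡 n) q →L[ℝ] TangentSpace (𝓡 n) q →L[ℝ] ℝ)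
    (hg : ∀ q u v, g q u v = B q (sphereIncl q u) (sphereIncl q v)) :
    ContMDiff (𝓡 n) ((𝓡 n).prod 𝓘(ℝ, EuclideanSpace ℝ (Fin n) →L[ℝ]
      EuclideanSpace ℝ (Fin n) →L[ℝ] ℝ)) ∞
      (fun q : Metric.sphere (0 : E) 1 => Bundle.TotalSpace.mk'
        (EuclideanSpace ℝ (Fin n) →L[ℝ] EuclideanSpace ℝ (Fin n) →L[ℝ] ℝ) q (g q)) := by
  intro q₀
  rw [contMDiffAt_hom_bundle]
  refine ⟨contMDiffAt_id, ?_⟩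
  have hL := (contMDiff_coe_sphere (E := E) (n := n) (m := ∞) q₀).mfderiv_const
    (m := ∞) (by simp)
  -- Composition acts on the first slot only; flipping twice reaches the second slot and restores
  -- the order.
  have h1 := (hB q₀).clm_comp hL
  have h2 := contDiff_flip.contMDiff.contMDiffAt.comp q₀ h1
  have h3 := h2.clm_comp hL
  have h4 := contDiff_flip.contMDiff.contMDiffAt.comp q₀ h3
  refine h4.congr_of_eventuallyEq ?_
  have hbase : ∀ᶠ q in 𝓝 q₀, q ∈ (trivializationAt (EuclideanSpace ℝ (Fin n))
      (TangentSpace (𝓡 n)) q₀ : Bundle.Trivialization _ _).baseSet :=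
    (trivializationAt (EuclideanSpace ℝ (Fin n)) (TangentSpace (𝓡 n)) q₀).open_baseSet.mem_nhds
      (FiberBundle.mem_baseSet_trivializationAt' q₀)
  filter_upwards [hbase] with q hq
  ext v w
  refine (inCoordinates_apply_eq₂ (E₃ := Bundle.Trivial (Metric.sphere (0 : E) 1) ℝ)
    (F₃ := ℝ) hq hq (mem_univ _)).trans ?_
  have hT : ∀ r : ℝ, (trivializationAt ℝ (Bundle.Trivial (Metric.sphere (0 : E) 1) ℝ)
      q₀).linearMapAt ℝ q r = r := fun r => by
    simp only [Bundle.Trivial.fiberBundle_trivializationAt',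
      Bundle.Trivial.linearMapAt_trivialization, LinearMap.id_coe, id_eq]
  refine (hT _).trans ((hg _ _ _).trans ?_)
  have hLv : ∀ v : EuclideanSpace ℝ (Fin n), inTangentCoordinates (𝓡 n) 𝓘(ℝ, E) id
      (Subtype.val : Metric.sphere (0 : E) 1 → E) (mfderiv (𝓡 n) 𝓘(ℝ, E) Subtype.val) q₀ q v =
      sphereIncl q ((trivializationAt (EuclideanSpace ℝ (Fin n)) (TangentSpace (𝓡 n)) q₀).symm q
        v) := by
    intro v
    simp only [inTangentCoordinates, ContinuousLinearMap.inCoordinates,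
      TangentBundle.continuousLinearMapAt_model_space]
    exact congrArg (sphereIncl q) (Bundle.Trivialization.symmL_apply _ hq v)
  change _ = B q (inTangentCoordinates (𝓡 n) 𝓘(ℝ, E) id
      (Subtype.val : Metric.sphere (0 : E) 1 → E) (mfderiv (𝓡 n) 𝓘(ℝ, E) Subtype.val) q₀ q v)
      (inTangentCoordinates (𝓡 n) 𝓘(ℝ, E) id
      (Subtype.val : Metric.sphere (0 : E) 1 → E) (mfderiv (𝓡 n) 𝓘(ℝ, E) Subtype.val) q₀ q w)
  rw [hLv, hLv]

/-- A smooth family of symmetric bilinear forms on the ambient space that is positive definite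
on tangent vectors induces a Riemannian metric on the unit sphere. -/
theorem exists_riemannianMetric_sphere
    {B : Metric.sphere (0 : E) 1 → E →L[ℝ] E →L[ℝ] ℝ}
    (hB : ContMDiff (𝓡 n) 𝓘(ℝ, E →L[ℝ] E →L[ℝ] ℝ) ∞ B)
    (hsymm : ∀ q u v, B q u v = B q v u)
    (hpos : ∀ (q : Metric.sphere (0 : E) 1) (u : E), inner ℝ (q : E) u = 0 → u ≠ 0 → 0 < B q u u) :
    ∃ G : Bundle.ContMDiffRiemannianMetric (𝓡 n) ∞ (EuclideanSpace ℝ (Fin n))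
      (fun q : Metric.sphere (0 : E) 1 => TangentSpace (𝓡 n) q),
      ∀ q u v, G.inner q u v = B q (sphereIncl q u) (sphereIncl q v) := by
  let g : ∀ q : Metric.sphere (0 : E) 1,
      EuclideanSpace ℝ (Fin n) →L[ℝ] EuclideanSpace ℝ (Fin n) →L[ℝ] ℝ :=
    fun q => (B q).bilinearComp (sphereIncl q) (sphereIncl q)
  have hg : ∀ q u v, g q u v = B q (sphereIncl q u) (sphereIncl q v) := fun _ _ _ => rfl
  have hgpos : ∀ q v, v ≠ 0 → 0 < g q v v := fun q v hv =>
    hpos q _ (inner_sphereIncl q v) fun h =>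
      hv (sphereIncl_injective q (h.trans (map_zero _).symm))
  refine ⟨⟨g, fun q u v => hsymm q _ _, hgpos, fun q => ?_, contMDiff_of_eq_pullback hB g hg⟩, hg⟩
  exact isVonNBounded_sublevel (g q) (hgpos q)

end Sphere

/-! ### Smoothness of a Riemannian metric along curves in the sphere -/

section Sphere

variable {E : Type*} [NormedAddCommGroup E] [InnerProductSpace ℝ E] {n : ℕ}
  [Fact (Module.finrank ℝ E = n + 1)]

/-- Tangent vectors at equal base points are identified through their ambient images, which avoids
transport between tangent spaces. -/
theorem inner_eq_of_sphereIncl_eq (g : ∀ q : Metric.sphere (0 : E) 1,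
      TangentSpace (𝓡 n) q →L[ℝ] TangentSpace (𝓡 n) q →L[ℝ] ℝ)
    {q q' : Metric.sphere (0 : E) 1} {u u' v v' : EuclideanSpace ℝ (Fin n)} (hq : q = q')
    (hu : sphereIncl q u = sphereIncl q' u') (hv : sphereIncl q v = sphereIncl q' v') :
    g q u v = g q' u' v' := by
  subst hq
  rw [sphereIncl_injective q hu, sphereIncl_injective q hv]

theorem contMDiff_vectorField_along_curve {X : Type*} [NormedAddCommGroup X] [NormedSpace ℝ X]
    {c : ℝ → X} (hc : ContDiff ℝ ∞ c) (v : X) :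
    ContMDiff 𝓘(ℝ, ℝ) 𝓘(ℝ, X).tangent ∞
      (fun s => (⟨c s, v⟩ : TangentBundle 𝓘(ℝ, X) X)) := by
  intro s
  rw [Bundle.contMDiffAt_totalSpace]
  refine ⟨hc.contMDiff s, ?_⟩
  simpa using contMDiffAt_const

theorem sphereIncl_mfderiv {X : Type*} [NormedAddCommGroup X] [NormedSpace ℝ X]
    {f : X → Metric.sphere (0 : E) 1} {p : X} (hf : MDifferentiableAt 𝓘(ℝ, X) (𝓡 n) f p) (v : X) :
    sphereIncl (f p) (mfderiv 𝓘(ℝ, X) (𝓡 n) f p v) = fderiv ℝ (fun x => (f x : E)) p v := by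
  have h := mfderiv_comp_apply p
    ((contMDiff_coe_sphere (E := E) (n := n) (m := ∞) (f p)).mdifferentiableAt (by simp)) hf v
  rw [← mfderiv_eq_fderiv]
  exact h.symm

/-- Only the ambient image w of the field u is known to be smooth. The field is recovered as the
variation field at τ = 0 of the smooth surface obtained by normalizing c(s) + τ w(s), and tangent
maps of smooth maps are smooth. -/
theorem contDiff_inner_along_curve (G : Bundle.ContMDiffRiemannianMetric (𝓡 n) ∞
      (EuclideanSpace ℝ (Fin n)) (fun q : Metric.sphere (0 : E) 1 => TangentSpace (𝓡 n) q))
    {c : ℝ → Metric.sphere (0 : E) 1} {w : ℝ → E} (hc : ContDiff ℝ ∞ fun s => (c s : E))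
    (hw : ContDiff ℝ ∞ w) {u : ℝ → EuclideanSpace ℝ (Fin n)} (hu : ∀ s, sphereIncl (c s) (u s) = w s) :
    ContDiff ℝ ∞ fun s => G.inner (c s) (u s) (u s) := by
  -- Since w is orthogonal to the unit vector c, |c + τw|² = 1 + τ²|w|². The normalizing factor is
  -- stationary at τ = 0, so the τ-derivative there is w.
  let f : ℝ × ℝ → E := fun p => (√(1 + p.2 ^ 2 * ‖w p.1‖ ^ 2))⁻¹ • ((c p.1 : E) + p.2 • w p.1)
  have hpos : ∀ p : ℝ × ℝ, 0 < 1 + p.2 ^ 2 * ‖w p.1‖ ^ 2 := fun p => by positivity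
  have hf : ContDiff ℝ ∞ f := by
    have hc' : ContDiff ℝ ∞ fun p : ℝ × ℝ => (c p.1 : E) := hc.comp contDiff_fst
    have hw' : ContDiff ℝ ∞ fun p : ℝ × ℝ => w p.1 := hw.comp contDiff_fst
    have h1 : ContDiff ℝ ∞ fun p : ℝ × ℝ => 1 + p.2 ^ 2 * ‖w p.1‖ ^ 2 :=
      contDiff_const.add ((contDiff_snd.pow 2).mul (hw'.norm_sq ℝ))
    exact ((h1.sqrt fun p => (hpos p).ne').inv fun p => (Real.sqrt_pos.2 (hpos p)).ne').smul
      (hc'.add (contDiff_snd.smul hw'))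
  have hfs : ∀ p, f p ∈ Metric.sphere (0 : E) 1 := by
    intro p
    have h1 : inner ℝ (c p.1 : E) (w p.1) = 0 := by rw [← hu]; exact inner_sphereIncl _ _
    have h2 : ‖(c p.1 : E) + p.2 • w p.1‖ = √(1 + p.2 ^ 2 * ‖w p.1‖ ^ 2) := by
      rw [eq_comm, Real.sqrt_eq_iff_eq_sq (hpos p).le (norm_nonneg _), norm_add_sq_real,
        inner_smul_right, h1, norm_smul, norm_eq_of_mem_sphere, mul_pow, Real.norm_eq_abs, sq_abs]
      ring
    rw [mem_sphere_zero_iff_norm, norm_smul, h2, norm_inv, Real.norm_of_nonneg (Real.sqrt_nonneg _),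
      inv_mul_cancel₀ (Real.sqrt_pos.2 (hpos p)).ne']
  let Q : ℝ × ℝ → Metric.sphere (0 : E) 1 := fun p => ⟨f p, hfs p⟩
  have hQ : ContMDiff 𝓘(ℝ, ℝ × ℝ) (𝓡 n) ∞ Q := hf.contMDiff.codRestrict_sphere hfs
  have hbase : ∀ s, Q (s, 0) = c s := fun s => Subtype.ext (by simp [Q, f])
  have hder : ∀ s, fderiv ℝ f (s, 0) (0, 1) = w s := by
    intro s
    have h1 : HasDerivAt (fun τ : ℝ => (s, τ)) ((0 : ℝ), (1 : ℝ)) 0 :=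
      (hasDerivAt_const (0 : ℝ) s).prodMk (hasDerivAt_id 0)
    have h2 := ((hf.differentiable (by simp) (s, 0)).hasFDerivAt).comp_hasDerivAt (0 : ℝ) h1
    have h3 : HasDerivAt (fun τ : ℝ => 1 + τ ^ 2 * ‖w s‖ ^ 2) 0 0 := by
      refine (((hasDerivAt_pow 2 (0 : ℝ)).mul_const (‖w s‖ ^ 2)).const_add 1).congr_deriv ?_
      simp
    have h4 := (h3.sqrt (by simp)).inv (by simp)
    have h5 : HasDerivAt (fun τ : ℝ => (c s : E) + τ • w s) (w s) 0 := by
      simpa using ((hasDerivAt_id (0 : ℝ)).smul_const (w s)).const_add (c s : E)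
    refine h2.unique ((h4.smul h5).congr_deriv ?_)
    simp
  have hT := (hQ.contMDiff_tangentMap (m := ∞) (by simp)).comp
    (contMDiff_vectorField_along_curve (X := ℝ × ℝ) (c := fun s => (s, (0 : ℝ)))
      (contDiff_id.prodMk contDiff_const) (0, 1))
  let V : ∀ s : ℝ, TangentSpace (𝓡 n) (Q (s, 0)) := fun s =>
    mfderiv 𝓘(ℝ, ℝ × ℝ) (𝓡 n) Q (s, 0) ((0, 1) : ℝ × ℝ)
  have hb : ContMDiff 𝓘(ℝ, ℝ) (𝓡 n) ∞ fun s : ℝ => Q (s, 0) :=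
    hQ.comp (contDiff_id.prodMk contDiff_const).contMDiff
  have hV : ContMDiff 𝓘(ℝ, ℝ) ((𝓡 n).prod 𝓘(ℝ, EuclideanSpace ℝ (Fin n))) ∞ fun s : ℝ =>
      Bundle.TotalSpace.mk' (EuclideanSpace ℝ (Fin n)) (Q (s, 0)) (V s) := hT
  have hmain : ContMDiff 𝓘(ℝ, ℝ) ((𝓡 n).prod 𝓘(ℝ, ℝ)) ∞ fun s : ℝ =>
      Bundle.TotalSpace.mk' ℝ (E := Bundle.Trivial (Metric.sphere (0 : E) 1) ℝ) (Q (s, 0))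
        (G.inner (Q (s, 0)) (V s) (V s)) :=
    ContMDiff.clm_bundle_apply₂ (F₁ := EuclideanSpace ℝ (Fin n)) (F₂ := EuclideanSpace ℝ (Fin n))
      (G.contMDiff.comp hb) hV hV
  have hfun : ContMDiff 𝓘(ℝ, ℝ) 𝓘(ℝ, ℝ) ∞ fun s : ℝ => G.inner (Q (s, 0)) (V s) (V s) := by
    intro s
    have := hmain s
    rw [Bundle.contMDiffAt_totalSpace] at this
    exact this.2
  have hVs : ∀ s, sphereIncl (c s) (u s) = sphereIncl (Q (s, 0)) (V s) := by
    intro s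
    rw [hu]
    exact ((sphereIncl_mfderiv ((hQ (s, 0)).mdifferentiableAt (by simp)) _).trans (hder s)).symm
  have heq : (fun s => G.inner (c s) (u s) (u s)) = fun s => G.inner (Q (s, 0)) (V s) (V s) :=
    funext fun s => inner_eq_of_sphereIncl_eq G.inner (hbase s).symm (hVs s) (hVs s)
  rw [heq]
  exact hfun.contDiff

end Sphere
-- The differential of the join parametrization
instance finrank_euc (k : ℕ) : Fact (Module.finrank ℝ (Euc (k + 1)) = k + 1) :=
  ⟨finrank_euclideanSpace_fin⟩

/-- The scaling factor between arclength on `(0, l)` and angle on the join. -/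
noncomputable def joinFreq (l : ℝ) : ℝ := Real.pi / (2 * l)

theorem joinMap_angle (l s : ℝ) : Real.pi * s / (2 * l) = joinFreq l * s := by
  rw [joinFreq]; ring

theorem hasMFDerivAt_prodMk_space {X Y Z H M : Type*} [NormedAddCommGroup X] [NormedSpace ℝ X]
    [NormedAddCommGroup Y] [NormedSpace ℝ Y] [NormedAddCommGroup Z] [NormedSpace ℝ Z]
    [TopologicalSpace H] {I : ModelWithCorners ℝ X H} [TopologicalSpace M] [ChartedSpace H M]
    {x : M} {f : M → Y} {g : M → Z} {df : TangentSpace I x →L[ℝ] Y} {dg : TangentSpace I x →L[ℝ] Z}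
    (hf : HasMFDerivAt I 𝓘(ℝ, Y) f x df) (hg : HasMFDerivAt I 𝓘(ℝ, Z) g x dg) :
    HasMFDerivAt I 𝓘(ℝ, Y × Z) (fun y => (f y, g y)) x (df.prod dg) :=
  ⟨hf.1.prodMk hg.1, hf.2.prodMk hg.2⟩

theorem hasFDerivAt_join {m : ℕ} (k : ℝ) (p : ℝ × Euc (m + 1) × Euc 2) :
    ∃ D : ℝ × Euc (m + 1) × Euc 2 →L[ℝ] JoinSpace m,
      HasFDerivAt (fun p : ℝ × Euc (m + 1) × Euc 2 =>
        (WithLp.toLp 2 (Real.sin (k * p.1) • p.2.1, Real.cos (k * p.1) • p.2.2) : JoinSpace m))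
        D p ∧ ∀ v, D v = WithLp.toLp 2
          ((k * Real.cos (k * p.1) * v.1) • p.2.1 + Real.sin (k * p.1) • v.2.1,
            (-(k * Real.sin (k * p.1) * v.1)) • p.2.2 + Real.cos (k * p.1) • v.2.2) := by
  have h1 : HasFDerivAt (fun p : ℝ × Euc (m + 1) × Euc 2 => k * p.1)
      (k • ContinuousLinearMap.fst ℝ ℝ (Euc (m + 1) × Euc 2)) p := hasFDerivAt_fst.const_mul k
  have hX : HasFDerivAt (fun p : ℝ × Euc (m + 1) × Euc 2 => p.2.1) _ p :=
    ((ContinuousLinearMap.fst ℝ (Euc (m + 1)) (Euc 2)).comp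
      (ContinuousLinearMap.snd ℝ ℝ _)).hasFDerivAt
  have hΘ : HasFDerivAt (fun p : ℝ × Euc (m + 1) × Euc 2 => p.2.2) _ p :=
    ((ContinuousLinearMap.snd ℝ (Euc (m + 1)) (Euc 2)).comp
      (ContinuousLinearMap.snd ℝ ℝ _)).hasFDerivAt
  have h2 := (h1.sin.smul hX).prodMk (h1.cos.smul hΘ)
  have h3 := (WithLp.prodContinuousLinearEquiv 2 ℝ (Euc (m + 1)) (Euc 2)).symm.hasFDerivAt.comp p h2
  refine ⟨_, h3, fun v => ?_⟩
  change WithLp.toLp 2 _ = _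
  congr 1
  ext i
  · simp; ring
  · simp; ring

theorem contMDiff_joinMap {m : ℕ} (l : ℝ) :
    ContMDiff (cylModel m) (𝓡 (m + 2)) ∞ (joinMap (m := m) l) := by
  have h0 : ContMDiff (cylModel m) 𝓘(ℝ, ℝ) ∞ fun p : ℝ × Sph m × Sph 1 => p.1 := contMDiff_fst
  have h1 : ContMDiff (cylModel m) 𝓘(ℝ, Euc (m + 1)) ∞
      fun p : ℝ × Sph m × Sph 1 => (p.2.1 : Euc (m + 1)) :=
    contMDiff_coe_sphere.comp (contMDiff_fst.comp contMDiff_snd)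
  have h2 : ContMDiff (cylModel m) 𝓘(ℝ, Euc 2) ∞
      fun p : ℝ × Sph m × Sph 1 => (p.2.2 : Euc 2) :=
    contMDiff_coe_sphere.comp (contMDiff_snd.comp contMDiff_snd)
  have h3 := h0.prodMk_space (h1.prodMk_space h2)
  have h4 : ContDiff ℝ ∞ (fun p : ℝ × Euc (m + 1) × Euc 2 =>
        (WithLp.toLp 2 (Real.sin (Real.pi * p.1 / (2 * l)) • p.2.1,
          Real.cos (Real.pi * p.1 / (2 * l)) • p.2.2) : JoinSpace m)) := by
    refine (WithLp.prodContinuousLinearEquiv 2 ℝ (Euc (m + 1)) (Euc 2)).symm.contDiff.comp ?_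
    fun_prop
  exact (h4.contMDiff.comp h3).codRestrict_sphere (joinMap_mem l)

/-- The formula for the join makes sense on the whole vector space, so its Fréchet derivative is
composed with the differentials of the two sphere inclusions. -/
theorem sphereIncl_mfderiv_joinMap {m : ℕ} (l : ℝ) (p : ℝ × Sph m × Sph 1)
    (u : TangentSpace (cylModel m) p) :
    sphereIncl (joinMap l p) (mfderiv (cylModel m) (𝓡 (m + 2)) (joinMap l) p u) =
      (WithLp.toLp 2
          ((joinFreq l * Real.cos (joinFreq l * p.1) * u.1) • (p.2.1 : Euc (m + 1)) +
            Real.sin (joinFreq l * p.1) • sphereIncl p.2.1 u.2.1,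
            (-(joinFreq l * Real.sin (joinFreq l * p.1) * u.1)) • (p.2.2 : Euc 2) +
              Real.cos (joinFreq l * p.1) • sphereIncl p.2.2 u.2.2) : JoinSpace m) := by
  have h := mfderiv_comp_apply p
    ((contMDiff_coe_sphere (E := JoinSpace m) (n := m + 2) (m := ∞)
      (joinMap l p)).mdifferentiableAt (by simp))
    ((contMDiff_joinMap l p).mdifferentiableAt (by simp)) u
  refine h.symm.trans ?_
  obtain ⟨D, hD, hDv⟩ := hasFDerivAt_join (m := m) (joinFreq l)
    (p.1, (p.2.1 : Euc (m + 1)), (p.2.2 : Euc 2))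
  have hcoe1 := ((contMDiff_coe_sphere (E := Euc (m + 1)) (n := m) (m := ∞)
      p.2.1).mdifferentiableAt (by simp)).hasMFDerivAt
  have hcoe2 := ((contMDiff_coe_sphere (E := Euc 2) (n := 1) (m := ∞)
      p.2.2).mdifferentiableAt (by simp)).hasMFDerivAt
  have h0 : HasMFDerivAt (cylModel m) 𝓘(ℝ, ℝ) (fun p : ℝ × Sph m × Sph 1 => p.1) p _ :=
    hasMFDerivAt_fst p
  have h1 : HasMFDerivAt (cylModel m) 𝓘(ℝ, Euc (m + 1))
      (fun p : ℝ × Sph m × Sph 1 => (p.2.1 : Euc (m + 1))) p _ :=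
    hcoe1.comp p ((hasMFDerivAt_fst p.2).comp p (hasMFDerivAt_snd p))
  have h2 : HasMFDerivAt (cylModel m) 𝓘(ℝ, Euc 2)
      (fun p : ℝ × Sph m × Sph 1 => (p.2.2 : Euc 2)) p _ :=
    hcoe2.comp p ((hasMFDerivAt_snd p.2).comp p (hasMFDerivAt_snd p))
  have h3 := HasMFDerivAt.comp p hD.hasMFDerivAt
    (hasMFDerivAt_prodMk_space h0 (hasMFDerivAt_prodMk_space h1 h2))
  have h4 : (Subtype.val ∘ joinMap (m := m) l) = ((fun p : ℝ × Euc (m + 1) × Euc 2 =>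
        (WithLp.toLp 2 (Real.sin (joinFreq l * p.1) • p.2.1,
          Real.cos (joinFreq l * p.1) • p.2.2) : JoinSpace m)) ∘
      fun p : ℝ × Sph m × Sph 1 => (p.1, (p.2.1 : Euc (m + 1)), (p.2.2 : Euc 2))) := by
    funext q
    simp only [Function.comp_apply, joinMap, joinMap_angle]
  rw [h4, h3.mfderiv]
  exact hDv _

/-! ### Necessity: lengths of ambient vectors along a meridian -/

section AmbientSq

variable {E : Type*} [NormedAddCommGroup E] [InnerProductSpace ℝ E] {n : ℕ}
  [Fact (Module.finrank ℝ E = n + 1)]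

/-- The square of the length of an ambient vector tangent to the unit sphere. -/
noncomputable def ambientSq (G : Bundle.ContMDiffRiemannianMetric (𝓡 n) ∞
      (EuclideanSpace ℝ (Fin n)) (fun q : Metric.sphere (0 : E) 1 => TangentSpace (𝓡 n) q))
    (q : Metric.sphere (0 : E) 1) (w : E) : ℝ :=
  G.inner q (Function.invFun (sphereIncl (n := n) q) w)
    (Function.invFun (sphereIncl (n := n) q) w)

variable (G : Bundle.ContMDiffRiemannianMetric (𝓡 n) ∞
      (EuclideanSpace ℝ (Fin n)) (fun q : Metric.sphere (0 : E) 1 => TangentSpace (𝓡 n) q))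

theorem ambientSq_sphereIncl (q : Metric.sphere (0 : E) 1) (u : EuclideanSpace ℝ (Fin n)) :
    ambientSq G q (sphereIncl q u) = G.inner q u u := by
  have h := Function.leftInverse_invFun (sphereIncl_injective (n := n) q) u
  exact congrArg₂ (fun a b : EuclideanSpace ℝ (Fin n) => G.inner q a b) h h

theorem ambientSq_smul {q : Metric.sphere (0 : E) 1} {w : E} (hw : inner ℝ (q : E) w = 0) (t : ℝ) :
    ambientSq G q (t • w) = t ^ 2 * ambientSq G q w := by
  obtain ⟨u, rfl⟩ := (exists_sphereIncl_eq_iff (n := n) q w).2 hw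
  rw [← map_smul, ambientSq_sphereIncl, ambientSq_sphereIncl]
  have h : G.inner q (t • u : EuclideanSpace ℝ (Fin n)) (t • u : EuclideanSpace ℝ (Fin n))
      = t • t • G.inner q u u :=
    ((G.inner q (t • u : EuclideanSpace ℝ (Fin n))).map_smul t u).trans
      (congrArg (t • ·) (congrArg (fun f : TangentSpace (𝓡 n) q →L[ℝ] ℝ => f u)
        ((G.inner q).map_smul t u)))
  rw [h, smul_eq_mul, smul_eq_mul]
  ring

theorem contDiff_ambientSq {c : ℝ → Metric.sphere (0 : E) 1} {w : ℝ → E}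
    (hc : ContDiff ℝ ∞ fun s => (c s : E)) (hw : ContDiff ℝ ∞ w)
    (h : ∀ s, inner ℝ (c s : E) (w s) = 0) : ContDiff ℝ ∞ fun s => ambientSq G (c s) (w s) :=
  contDiff_inner_along_curve G hc hw fun s =>
    Function.invFun_eq ((exists_sphereIncl_eq_iff (n := n) (c s) (w s)).2 (h s))

end AmbientSq

section Join

variable {m : ℕ} {l : ℝ} {γ Λ : ℝ → ℝ}

theorem joinMap_coe (l : ℝ) (p : ℝ × Sph m × Sph 1) :
    ((joinMap l p : JoinSph m) : JoinSpace m) = WithLp.toLp 2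
      (Real.sin (joinFreq l * p.1) • (p.2.1 : Euc (m + 1)),
        Real.cos (joinFreq l * p.1) • (p.2.2 : Euc 2)) := by
  simp only [joinMap, joinMap_angle]

theorem contDiff_toLp {f : ℝ → Euc (m + 1)} {g : ℝ → Euc 2} (hf : ContDiff ℝ ∞ f)
    (hg : ContDiff ℝ ∞ g) : ContDiff ℝ ∞ fun s => (WithLp.toLp 2 (f s, g s) : JoinSpace m) :=
  (WithLp.prodContinuousLinearEquiv 2 ℝ (Euc (m + 1)) (Euc 2)).symm.contDiff.comp (hf.prodMk hg)

theorem contDiff_joinMap_meridian (l : ℝ) (x : Sph m) (θ : Sph 1) :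
    ContDiff ℝ ∞ fun s => ((joinMap l (s, x, θ) : JoinSph m) : JoinSpace m) := by
  simp only [joinMap_coe]
  exact contDiff_toLp (by fun_prop) (by fun_prop)

/-- A meridian crosses the end where Sᵐ collapses and continues towards the antipode of x; this is
the source of evenness at 0. -/
theorem joinMap_neg (l s : ℝ) (x : Sph m) (θ : Sph 1) :
    joinMap l (-s, x, θ) = joinMap l (s, -x, θ) := by
  apply Subtype.ext
  simp [joinMap_coe]

theorem joinFreq_mul_self (hl : l ≠ 0) : joinFreq l * l = Real.pi / 2 := by
  rw [joinFreq]; field_simp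

theorem joinMap_reflect (hl : l ≠ 0) (s : ℝ) (x : Sph m) (θ : Sph 1) :
    joinMap l (2 * l - s, x, θ) = joinMap l (s, x, -θ) := by
  apply Subtype.ext
  have h : joinFreq l * (2 * l - s) = Real.pi - joinFreq l * s := by
    rw [mul_sub, mul_left_comm, joinFreq_mul_self hl]; ring
  simp [joinMap_coe, h, Real.sin_pi_sub, Real.cos_pi_sub]

/-- `G` restricts to the doubly warped metric on the open dense cylinder. -/
def RestrictsTo (G : Bundle.ContMDiffRiemannianMetric (𝓡 (m + 2)) ∞ (Euc (m + 2))
      (fun q : JoinSph m => TangentSpace (𝓡 (m + 2)) q)) (l : ℝ) (γ Λ : ℝ → ℝ) : Prop :=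
  ∀ p : ℝ × Sph m × Sph 1, p.1 ∈ Ioo 0 l → ∀ u v : TangentSpace (cylModel m) p,
    G.inner (joinMap l p) (mfderiv (cylModel m) (𝓡 (m + 2)) (joinMap l) p u)
      (mfderiv (cylModel m) (𝓡 (m + 2)) (joinMap l) p v) = joinMetric γ Λ p u v

variable {G : Bundle.ContMDiffRiemannianMetric (𝓡 (m + 2)) ∞ (Euc (m + 2))
      (fun q : JoinSph m => TangentSpace (𝓡 (m + 2)) q)}

theorem RestrictsTo.ambientSq_eq (hG : RestrictsTo G l γ Λ) {s : ℝ} (hs : s ∈ Ioo 0 l) (x : Sph m)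
    (θ : Sph 1) (r : ℝ) {w : Euc (m + 1)} {w' : Euc 2} (hw : inner ℝ (x : Euc (m + 1)) w = 0)
    (hw' : inner ℝ (θ : Euc 2) w' = 0) :
    ambientSq G (joinMap l (s, x, θ)) (WithLp.toLp 2
      ((joinFreq l * Real.cos (joinFreq l * s) * r) • (x : Euc (m + 1)) +
          Real.sin (joinFreq l * s) • w,
        (-(joinFreq l * Real.sin (joinFreq l * s) * r)) • (θ : Euc 2) +
          Real.cos (joinFreq l * s) • w')) = r ^ 2 + γ s ^ 2 * ‖w‖ ^ 2 + Λ s ^ 2 * ‖w'‖ ^ 2 := by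
  obtain ⟨u, rfl⟩ := (exists_sphereIncl_eq_iff (n := m) x w).2 hw
  obtain ⟨u', rfl⟩ := (exists_sphereIncl_eq_iff (n := 1) θ w').2 hw'
  have h := sphereIncl_mfderiv_joinMap l (s, x, θ) (r, u, u')
  refine (congrArg (ambientSq G (joinMap l (s, x, θ))) h.symm).trans ?_
  refine (ambientSq_sphereIncl G _ _).trans ?_
  refine (hG (s, x, θ) hs (r, u, u') (r, u, u')).trans ?_
  simp only [joinMetric]
  rw [← real_inner_self_eq_norm_sq, ← real_inner_self_eq_norm_sq, ← pow_two]
  rfl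

theorem inner_joinMap_fst (l s : ℝ) (x : Sph m) (θ : Sph 1) {w : Euc (m + 1)}
    (hw : inner ℝ (x : Euc (m + 1)) w = 0) :
    inner ℝ ((joinMap l (s, x, θ) : JoinSph m) : JoinSpace m) (WithLp.toLp 2 (w, 0)) = 0 := by
  simp [joinMap_coe, inner_smul_left, hw]

theorem inner_joinMap_snd (l s : ℝ) (x : Sph m) (θ : Sph 1) {w : Euc 2}
    (hw : inner ℝ (θ : Euc 2) w = 0) :
    inner ℝ ((joinMap l (s, x, θ) : JoinSph m) : JoinSpace m) (WithLp.toLp 2 (0, w)) = 0 := by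
  simp [joinMap_coe, inner_smul_left, hw]

/-- The vector sin(ks)(w, 0) comes from a unit vector tangent to Sᵐ and has squared length γ².
Without the factor sin(ks), the vector (w, 0) still makes sense at the collapsed end. -/
theorem RestrictsTo.sq_eq_fst (hG : RestrictsTo G l γ Λ) {s : ℝ} (hs : s ∈ Ioo 0 l) (x : Sph m)
    (θ : Sph 1) {w : Euc (m + 1)} (hw : inner ℝ (x : Euc (m + 1)) w = 0) (hw1 : ‖w‖ = 1) :
    γ s ^ 2 = Real.sin (joinFreq l * s) ^ 2 *
      ambientSq G (joinMap l (s, x, θ)) (WithLp.toLp 2 (w, 0)) := by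
  have h := hG.ambientSq_eq hs x θ 0 (w' := 0) hw (by simp)
  rw [← ambientSq_smul G (inner_joinMap_fst l s x θ hw)]
  simp only [mul_zero, zero_smul, neg_zero, zero_add, smul_zero, hw1, norm_zero] at h
  rw [← WithLp.toLp_smul, Prod.smul_mk, smul_zero, h]
  ring

theorem RestrictsTo.sq_eq_snd (hG : RestrictsTo G l γ Λ) {s : ℝ} (hs : s ∈ Ioo 0 l) (x : Sph m)
    (θ : Sph 1) {w : Euc 2} (hw : inner ℝ (θ : Euc 2) w = 0) (hw1 : ‖w‖ = 1) :
    Λ s ^ 2 = Real.cos (joinFreq l * s) ^ 2 *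
      ambientSq G (joinMap l (s, x, θ)) (WithLp.toLp 2 (0, w)) := by
  have h := hG.ambientSq_eq hs x θ 0 (w := 0) (by simp) hw
  rw [← ambientSq_smul G (inner_joinMap_snd l s x θ hw)]
  simp only [mul_zero, zero_smul, neg_zero, zero_add, smul_zero, hw1, norm_zero] at h
  rw [← WithLp.toLp_smul, Prod.smul_mk, smul_zero, h]
  ring

/-- Meridians have unit speed, also at the two ends. -/
theorem RestrictsTo.ambientSq_meridian (hG : RestrictsTo G l γ Λ) (hl : 0 < l) {s : ℝ}
    (hs : s ∈ Icc 0 l) (x : Sph m) (θ : Sph 1) :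
    ambientSq G (joinMap l (s, x, θ)) (WithLp.toLp 2
      ((joinFreq l * Real.cos (joinFreq l * s)) • (x : Euc (m + 1)),
        (-(joinFreq l * Real.sin (joinFreq l * s))) • (θ : Euc 2))) = 1 := by
  have hcont := (contDiff_ambientSq G (contDiff_joinMap_meridian l x θ)
    (w := fun s => WithLp.toLp 2
      ((joinFreq l * Real.cos (joinFreq l * s)) • (x : Euc (m + 1)),
        (-(joinFreq l * Real.sin (joinFreq l * s))) • (θ : Euc 2)))
    (contDiff_toLp (by fun_prop) (by fun_prop)) fun s => by
      simp [joinMap_coe, inner_smul_left, inner_smul_right]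
      ring).continuous
  have hEq : EqOn (fun s => ambientSq G (joinMap l (s, x, θ)) (WithLp.toLp 2
      ((joinFreq l * Real.cos (joinFreq l * s)) • (x : Euc (m + 1)),
        (-(joinFreq l * Real.sin (joinFreq l * s))) • (θ : Euc 2)))) (fun _ => 1) (Ioo 0 l) := by
    intro s hs
    have h := hG.ambientSq_eq hs x θ 1 (w := 0) (w' := 0) (by simp) (by simp)
    simpa using h
  have := hEq.closure hcont continuous_const
  rw [closure_Ioo hl.ne] at this
  exact this hs

theorem exists_smooth_extension_data (hm : 1 ≤ m) (hl : 0 < l) (hext : ExtendsSmoothly m l γ Λ) :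
    ∃ H K : ℝ → ℝ, ContDiff ℝ ∞ H ∧ ContDiff ℝ ∞ K ∧
      (∀ s ∈ Ioo 0 l, γ s ^ 2 = Real.sin (joinFreq l * s) ^ 2 * H s) ∧
      (∀ s ∈ Ioo 0 l, Λ s ^ 2 = Real.cos (joinFreq l * s) ^ 2 * K s) ∧
      (∀ s ∈ Ioo 0 l, H (-s) = H s) ∧ (∀ s ∈ Ioo 0 l, H (2 * l - s) = H s) ∧
      joinFreq l ^ 2 * H 0 = 1 ∧ joinFreq l ^ 2 * K l = 1 := by
  obtain ⟨G, hG⟩ := hext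
  have hG : RestrictsTo G l γ Λ := hG
  obtain ⟨x, w, hw⟩ : ∃ x w : Sph m, inner ℝ (x : Euc (m + 1)) (w : Euc (m + 1)) = 0 := by
    -- The first and last basis vectors differ because m ≥ 1.
    refine ⟨⟨EuclideanSpace.single 0 1, by simp⟩, ⟨EuclideanSpace.single (Fin.last m) 1, by simp⟩, ?_⟩
    have : (0 : Fin (m + 1)) ≠ Fin.last m := fun h => by
      have := congrArg Fin.val h
      simp at this
      omega
    rw [EuclideanSpace.inner_single_left]
    simp [this]
  obtain ⟨θ, w', hw'⟩ : ∃ θ w : Sph 1, inner ℝ (θ : Euc 2) (w : Euc 2) = 0 :=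
    ⟨⟨EuclideanSpace.single 0 1, by simp⟩, ⟨EuclideanSpace.single 1 1, by simp⟩, by
      rw [EuclideanSpace.inner_single_left]; simp⟩
  have hw1 : ‖(w : Euc (m + 1))‖ = 1 := norm_eq_of_mem_sphere w
  have hw1' : ‖(w' : Euc 2)‖ = 1 := norm_eq_of_mem_sphere w'
  have hsin : ∀ s ∈ Ioo 0 l, Real.sin (joinFreq l * s) ^ 2 ≠ 0 := by
    intro s hs
    have hk : 0 < joinFreq l := by rw [joinFreq]; positivity
    refine pow_ne_zero 2 (Real.sin_pos_of_pos_of_lt_pi (mul_pos hk hs.1) ?_).ne'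
    have := mul_lt_mul_of_pos_left hs.2 hk
    rw [joinFreq_mul_self hl.ne'] at this
    linarith [Real.pi_pos]
  refine ⟨fun s => ambientSq G (joinMap l (s, x, θ)) (WithLp.toLp 2 ((w : Euc (m + 1)), 0)),
    fun s => ambientSq G (joinMap l (s, x, θ)) (WithLp.toLp 2 (0, (w' : Euc 2))),
    contDiff_ambientSq G (contDiff_joinMap_meridian l x θ) contDiff_const
      fun s => inner_joinMap_fst l s x θ hw,
    contDiff_ambientSq G (contDiff_joinMap_meridian l x θ) contDiff_const
      fun s => inner_joinMap_snd l s x θ hw',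
    fun s hs => hG.sq_eq_fst hs x θ hw hw1, fun s hs => hG.sq_eq_snd hs x θ hw' hw1',
    fun s hs => ?_, fun s hs => ?_, ?_, ?_⟩
  · simp only [joinMap_neg]
    refine mul_left_cancel₀ (hsin s hs) ?_
    -- The same γ(s)² is computed from the meridians through x and through -x.
    rw [← hG.sq_eq_fst hs x θ hw hw1, ← hG.sq_eq_fst hs (-x) θ (by simpa using hw) hw1]
  · simp only [joinMap_reflect hl.ne']
    refine mul_left_cancel₀ (hsin s hs) ?_
    rw [← hG.sq_eq_fst hs x θ hw hw1, ← hG.sq_eq_fst hs x (-θ) hw hw1]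
  -- For fixed θ all meridians start at the same point; the one through w in place of x leaves it
  -- with velocity (k w, 0), of length 1.
  · have h := hG.ambientSq_meridian hl ⟨le_rfl, hl.le⟩ w θ
    have hpt : joinMap l (0, w, θ) = joinMap l (0, x, θ) := by
      apply Subtype.ext
      simp [joinMap_coe]
    rw [hpt] at h
    rw [← ambientSq_smul G (inner_joinMap_fst l 0 x θ hw)]
    refine Eq.trans ?_ h
    congr 1
    simp [← WithLp.toLp_smul]
  -- Likewise the meridian with w' in place of θ arrives at the other end with velocity (0, -k w').
  · have h := hG.ambientSq_meridian hl ⟨hl.le, le_rfl⟩ x w'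
    have hpt : joinMap l (l, x, w') = joinMap l (l, x, θ) := by
      apply Subtype.ext
      simp [joinMap_coe, joinFreq_mul_self hl.ne']
    rw [hpt] at h
    rw [← neg_sq, ← ambientSq_smul G (inner_joinMap_snd l l x θ hw')]
    refine Eq.trans ?_ h
    congr 1
    simp [← WithLp.toLp_smul, ← WithLp.toLp_neg, joinFreq_mul_self hl.ne']

end Join

/-! ### Necessity: from the smooth lengths to the expansions of γ -/

theorem hasDerivAt_zero_of_eq_add_mul {f g : ℝ → ℝ} (hg : ContDiff ℝ ∞ g) {y : ℝ}
    (h : ∀ t, f t = y + t * g t) : HasDerivAt f (g 0) 0 := by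
  rw [funext h]
  refine (((hasDerivAt_id (0 : ℝ)).mul
    (hg.differentiable (by simp) 0).hasDerivAt).const_add y).congr_deriv ?_
  simp

theorem exists_sin_eq_mul (k : ℝ) :
    ∃ σ : ℝ → ℝ, ContDiff ℝ ∞ σ ∧ (∀ s, σ (-s) = σ s) ∧ σ 0 = k ∧
      ∀ s, Real.sin (k * s) = s * σ s := by
  obtain ⟨σ, hσ, h⟩ := exists_contDiff_eq_add_mul (f := fun s => Real.sin (k * s)) (by fun_prop)
  have h0 : Real.sin (k * 0) = 0 := by simp
  simp only [h0, zero_add] at h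
  refine ⟨σ, hσ, fun s => ?_, ?_, h⟩
  · rcases eq_or_ne s 0 with rfl | hs
    · simp
    · have h1 := h (-s)
      rw [mul_neg, Real.sin_neg, h s] at h1
      exact mul_left_cancel₀ hs (by linarith)
  · have h1 := hasDerivAt_zero_of_eq_add_mul (y := 0) hσ fun t => (h t).trans (zero_add _).symm
    have h2 : HasDerivAt (fun s => Real.sin (k * s)) k 0 := by
      have := ((hasDerivAt_id (0 : ℝ)).const_mul k).sin
      simpa using this
    exact h1.unique h2

theorem exists_pos_near {f : ℝ → ℝ} (hf : Continuous f) {x : ℝ} (hx : 0 < f x) :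
    ∃ δ > 0, ∀ t ∈ Ioo (-δ) δ, 0 < f (x + t) := by
  obtain ⟨δ, hδ, h⟩ := Metric.eventually_nhds_iff.1 (hf.continuousAt.eventually_const_lt hx)
  refine ⟨δ, hδ, fun t ht => h ?_⟩
  rw [Real.dist_eq, add_sub_cancel_left]
  exact abs_lt.2 ht

theorem even_on_of_even_on_pos {f : ℝ → ℝ} {δ : ℝ} (h : ∀ t ∈ Ioo 0 δ, f (-t) = f t) :
    ∀ t ∈ Ioo (-δ) δ, f (-t) = f t := by
  intro t ht
  rcases lt_trichotomy t 0 with h0 | rfl | h0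
  · have := h (-t) ⟨by linarith, by linarith [ht.1]⟩
    rw [neg_neg] at this
    exact this.symm
  · simp
  · exact h t ⟨h0, ht.2⟩

theorem exists_contDiff_eq_add_sq_mul {f : ℝ → ℝ} {δ : ℝ} (hδ : 0 < δ)
    (hf : ContDiffOn ℝ ∞ f (Ioo (-δ) δ)) (he : ∀ t ∈ Ioo 0 δ, f (-t) = f t) :
    ∃ a : ℝ → ℝ, ContDiff ℝ ∞ a ∧
      ∀ t ∈ Ioo (-(δ / 4)) (δ / 4), f t = f 0 + t ^ 2 * a (t ^ 2) := by
  obtain ⟨g, hg, hfg⟩ := exists_contDiff_comp_sq_near_zero hδ hf (even_on_of_even_on_pos he)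
  obtain ⟨a, ha, hga⟩ := exists_contDiff_eq_add_mul hg
  refine ⟨a, ha, fun t ht => ?_⟩
  have h0 := hfg 0 ⟨by linarith, by linarith⟩
  rw [hfg t ht, hga, h0]
  simp

/-- Only the values on the open interval matter, so γ, arbitrary outside (0, l), may be replaced by
a smooth representative. -/
theorem warp_eq_of_eqOn {c l s : ℝ} {γ Γ : ℝ → ℝ} (hs : s ∈ Ioo 0 l) (h : EqOn γ Γ (Ioo 0 l)) :
    warp c l γ s = warp c l Γ s := by
  unfold warp
  congr 1
  rw [intervalIntegral.integral_of_le hs.2.le, intervalIntegral.integral_of_le hs.2.le,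
    integral_Ioc_eq_integral_Ioo, integral_Ioc_eq_integral_Ioo]
  exact setIntegral_congr_fun measurableSet_Ioo fun t ht => h ⟨hs.1.trans ht.1, ht.2⟩

theorem hasDerivAt_warp {c l : ℝ} {Γ : ℝ → ℝ} (hΓ : Continuous Γ) (s : ℝ) :
    HasDerivAt (warp c l Γ) (-(c * Γ s)) s := by
  refine ((intervalIntegral.integral_hasDerivAt_left (hΓ.intervalIntegrable _ _)
    (hΓ.stronglyMeasurableAtFilter _ _) hΓ.continuousAt).const_mul c).congr_deriv ?_
  ring

theorem exists_even_expansions_of_extension_data {l c L : ℝ} (hl : 0 < l) (hc : 0 < c)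
    {γ H K : ℝ → ℝ} (hpos : ∀ s ∈ Ioo 0 l, 0 < γ s) (hL : 0 < L)
    (h1 : Tendsto γ (𝓝[<] l) (𝓝 L)) (hH : ContDiff ℝ ∞ H) (hK : ContDiff ℝ ∞ K)
    (hγH : ∀ s ∈ Ioo 0 l, γ s ^ 2 = Real.sin (joinFreq l * s) ^ 2 * H s)
    (hΛK : ∀ s ∈ Ioo 0 l, warp c l γ s ^ 2 = Real.cos (joinFreq l * s) ^ 2 * K s)
    (hH0 : ∀ s ∈ Ioo 0 l, H (-s) = H s) (hHl : ∀ s ∈ Ioo 0 l, H (2 * l - s) = H s)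
    (hHz : joinFreq l ^ 2 * H 0 = 1) (hKl : joinFreq l ^ 2 * K l = 1) :
    ∃ ε : ℝ, 0 < ε ∧ ε ≤ l ∧ ε ≤ 1 ∧ ∃ a b : ℝ → ℝ,
        ContDiffOn ℝ ∞ a (Ioo (-ε) ε) ∧ ContDiffOn ℝ ∞ b (Ioo (-ε) ε) ∧
        ∀ t ∈ Ioo 0 ε, γ t = t * (1 + t ^ 2 * a (t ^ 2)) ∧
          γ (l - t) = 1 / c + t ^ 2 * b (t ^ 2) := by
  have hk : 0 < joinFreq l := by
    have := Real.pi_pos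
    rw [joinFreq]; positivity
  have hkl : joinFreq l * l = Real.pi / 2 := joinFreq_mul_self hl.ne'
  set k := joinFreq l with hkdef
  let Γ : ℝ → ℝ := fun s => Real.sin (k * s) * √(H s)
  have hΓc : Continuous Γ := by
    have := hH.continuous
    fun_prop
  have hsin : ∀ s ∈ Ioo 0 l, 0 < Real.sin (k * s) := by
    intro s hs
    refine Real.sin_pos_of_pos_of_lt_pi (mul_pos hk hs.1) ?_
    have := mul_lt_mul_of_pos_left hs.2 hk
    linarith [Real.pi_pos]
  have hγΓ : EqOn γ Γ (Ioo 0 l) := by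
    intro s hs
    have hHs : 0 ≤ H s := by
      have h2 := pow_pos (hpos s hs) 2
      rw [hγH s hs] at h2
      exact (pos_of_mul_pos_right h2 (sq_nonneg _)).le
    simp only [Γ]
    rw [← sq_eq_sq₀ (hpos s hs).le (mul_nonneg (hsin s hs).le (Real.sqrt_nonneg _)), mul_pow,
      Real.sq_sqrt hHs, hγH s hs]
  have hIoo : Ioo 0 l ∈ 𝓝[<] l := Ioo_mem_nhdsLT hl
  have hΓl : √(H l) = L := by
    have h2 : Tendsto Γ (𝓝[<] l) (𝓝 L) := h1.congr' (by
      filter_upwards [hIoo] with s hs using hγΓ hs)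
    have h3 := tendsto_nhds_unique h2 (hΓc.continuousAt.tendsto.mono_left nhdsWithin_le_nhds)
    simp only [Γ, hkl, Real.sin_pi_div_two, one_mul] at h3
    exact h3.symm
  have hHlpos : 0 < H l := Real.sqrt_pos.1 (hΓl ▸ hL)
  have hIio : Iio l ⊆ ({l} : Set ℝ)ᶜ := fun s hs => ne_of_lt hs
  have hcL : c * L = 1 := by
    have hw := (hasDerivAt_warp (c := c) (l := l) hΓc l).tendsto_slope.mono_left
      (nhdsWithin_mono l hIio)
    have hcos : HasDerivAt (fun s => Real.cos (k * s)) (-k) l := by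
      have h2 := ((hasDerivAt_id l).const_mul k).cos
      refine h2.congr_deriv ?_
      simp [hkl]
    have hc' := hcos.tendsto_slope.mono_left
      (nhdsWithin_mono l hIio)
    have hKt : Tendsto K (𝓝[<] l) (𝓝 (K l)) :=
      hK.continuous.continuousAt.tendsto.mono_left nhdsWithin_le_nhds
    -- Both λ and cos(ks) vanish at l, so λ² = cos²(ks) K is a relation between squared slopes at l.
    -- Its limit is (cL)² = k² K(l) = 1.
    have h2 := tendsto_nhds_unique_of_eventuallyEq (hw.pow 2) ((hc'.pow 2).mul hKt) (by
      filter_upwards [hIoo] with s hs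
      have hwl : warp c l Γ l = 0 := by simp [warp]
      rw [slope_def_field, slope_def_field, hwl, hkl, Real.cos_pi_div_two,
        ← warp_eq_of_eqOn hs hγΓ, sub_zero, sub_zero, div_pow, div_pow, hΛK s hs]
      ring)
    have h3 : Γ l = L := by simp only [Γ, hkl, Real.sin_pi_div_two, one_mul, hΓl]
    rw [neg_sq, neg_sq, hKl, h3] at h2
    nlinarith [mul_pos hc hL]
  obtain ⟨σ, hσ, hσe, hσ0, hσs⟩ := exists_sin_eq_mul k
  have hHzpos : 0 < H 0 := pos_of_mul_pos_right (hHz ▸ one_pos) (sq_nonneg k)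
  obtain ⟨δ₀, hδ₀, hpos₀⟩ := exists_pos_near hH.continuous hHzpos
  obtain ⟨δ₁, hδ₁, hpos₁⟩ := exists_pos_near hH.continuous hHlpos
  let δ := min (min δ₀ δ₁) l
  have hδ : 0 < δ := lt_min (lt_min hδ₀ hδ₁) hl
  have hδδ₀ : δ ≤ δ₀ := (min_le_left _ _).trans (min_le_left _ _)
  have hδδ₁ : δ ≤ δ₁ := (min_le_left _ _).trans (min_le_right _ _)
  have hδl : δ ≤ l := min_le_right _ _
  -- Here σ √H is γ(s)/s, an even function with value k √(H 0) = 1 at 0.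
  obtain ⟨a, ha, hfa⟩ := exists_contDiff_eq_add_sq_mul (f := fun s => σ s * √(H s)) hδ
    (hσ.contDiffOn.mul (hH.contDiffOn.sqrt fun s hs => by
      have := hpos₀ s ⟨by linarith [hs.1], by linarith [hs.2]⟩
      rw [zero_add] at this
      exact this.ne'))
    (fun s hs => by simp only [hσe, hH0 s ⟨hs.1, by linarith [hs.2]⟩])
  -- This function is γ(l - s), even in s with value L = 1/c at 0.
  obtain ⟨b, hb, hfb⟩ := exists_contDiff_eq_add_sq_mul
    (f := fun s => Real.cos (k * s) * √(H (l - s))) hδ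
    ((by fun_prop : ContDiff ℝ ∞ fun s => Real.cos (k * s)).contDiffOn.mul
      ((hH.comp (contDiff_const.sub contDiff_id)).contDiffOn.sqrt fun s hs => by
      have := hpos₁ (-s) ⟨by linarith [hs.2], by linarith [hs.1]⟩
      exact this.ne'))
    (fun s hs => by
      have := hHl (l - s) ⟨by linarith [hs.2], by linarith [hs.1]⟩
      rw [show 2 * l - (l - s) = l - -s by ring] at this
      simp only [mul_neg, Real.cos_neg, this])
  have hfa0 : σ 0 * √(H 0) = 1 := by
    rw [hσ0, ← pow_left_inj₀ (mul_nonneg hk.le (Real.sqrt_nonneg _)) zero_le_one two_ne_zero,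
      mul_pow, Real.sq_sqrt hHzpos.le, hHz, one_pow]
  have hfb0 : Real.cos (k * 0) * √(H (l - 0)) = 1 / c := by
    rw [mul_zero, Real.cos_zero, one_mul, sub_zero, hΓl, eq_div_iff hc.ne', mul_comm, hcL]
  refine ⟨min (δ / 4) 1, lt_min (by positivity) one_pos,
    (min_le_left _ _).trans (by linarith), min_le_right _ _, a, b, ha.contDiffOn, hb.contDiffOn,
    fun t ht => ?_⟩
  have ht4 : t < δ / 4 := ht.2.trans_le (min_le_left _ _)
  have ht0 : 0 < t := ht.1
  constructor
  · rw [hγΓ (⟨ht0, by linarith⟩ : t ∈ Ioo 0 l)]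
    have := hfa t ⟨by linarith, ht4⟩
    rw [hfa0] at this
    rw [← this]
    simp only [Γ, hσs]
    ring
  · rw [hγΓ (⟨by linarith, by linarith⟩ : l - t ∈ Ioo 0 l)]
    have := hfb t ⟨by linarith, ht4⟩
    rw [hfb0] at this
    rw [← this]
    simp only [Γ]
    rw [mul_sub, hkl, Real.sin_pi_div_two_sub]

/-! ### Sufficiency: smooth functions of y = sin²(ks) -/

theorem exists_contDiff_glue {l η : ℝ} (hη : 0 < η) (hηl : 2 * η ≤ l) {f g₀ g₁ : ℝ → ℝ}
    (hf : ContDiffOn ℝ ∞ f (Ioo 0 l)) (hg₀ : ContDiff ℝ ∞ g₀) (hg₁ : ContDiff ℝ ∞ g₁)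
    (h₀ : ∀ t ∈ Ioo 0 η, f t = g₀ t) (h₁ : ∀ t ∈ Ioo 0 η, f (l - t) = g₁ t) :
    ∃ F : ℝ → ℝ, ContDiff ℝ ∞ F ∧ EqOn F f (Ioo 0 l) ∧ (∀ t < η, F t = g₀ t) ∧
      ∀ t < η, F (l - t) = g₁ t := by
  classical
  let F : ℝ → ℝ := fun t => if t < η then g₀ t else if l - η < t then g₁ (l - t) else f t
  have hF₀ : ∀ t < η, F t = g₀ t := fun t ht => if_pos ht
  have hF₁ : ∀ t < η, F (l - t) = g₁ t := by
    intro t ht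
    have h : ¬ l - t < η := by linarith
    simp only [F, if_neg h, if_pos (by linarith : l - η < l - t)]
    congr 1
    ring
  have hFf : EqOn F f (Ioo 0 l) := by
    intro t ht
    simp only [F]
    split_ifs with h h'
    · exact (h₀ t ⟨ht.1, h⟩).symm
    · have := h₁ (l - t) ⟨by linarith [ht.2], by linarith⟩
      rw [sub_sub_cancel] at this
      exact this.symm
    · rfl
  refine ⟨F, contDiff_iff_contDiffAt.2 fun t => ?_, hFf, hF₀, hF₁⟩
  by_cases h : t < η
  · refine hg₀.contDiffAt.congr_of_eventuallyEq ?_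
    filter_upwards [Iio_mem_nhds h] with s hs using hF₀ s hs
  · by_cases h' : l - η < t
    · refine ContDiffAt.congr_of_eventuallyEq (f := fun t => g₁ (l - t))
        (hg₁.comp (contDiff_const.sub contDiff_id)).contDiffAt ?_
      filter_upwards [Ioi_mem_nhds h'] with s hs
      have hs' : l - η < s := hs
      have := hF₁ (l - s) (by linarith)
      rwa [sub_sub_cancel] at this
    · have ht : t ∈ Ioo 0 l := ⟨by linarith, by linarith⟩
      refine (hf.contDiffAt (isOpen_Ioo.mem_nhds ht)).congr_of_eventuallyEq ?_
      filter_upwards [isOpen_Ioo.mem_nhds ht] with s hs using hFf hs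

/-- The reflection s ↦ l - s corresponds to y ↦ 1 - y, which reduces the end l to the end 0. -/
theorem arcsin_sqrt_eq_sub {y : ℝ} (hy : y ∈ Icc (0 : ℝ) 1) :
    Real.arcsin (√y) = Real.pi / 2 - Real.arcsin (√(1 - y)) := by
  have h := Real.arccos_eq_arcsin (Real.sqrt_nonneg (1 - y))
  rw [Real.sq_sqrt (by linarith [hy.2]), sub_sub_cancel] at h
  rw [← h, Real.arccos]

theorem joinFreq_pos {l : ℝ} (hl : 0 < l) : 0 < joinFreq l := by
  have := Real.pi_pos
  rw [joinFreq]; positivity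

theorem joinFreq_mul_mem {l s : ℝ} (hs : s ∈ Ioo 0 l) :
    joinFreq l * s ∈ Ioo 0 (Real.pi / 2) := by
  have hl := hs.1.trans hs.2
  have hk := joinFreq_pos hl
  refine ⟨mul_pos hk hs.1, ?_⟩
  rw [← joinFreq_mul_self hl.ne']
  exact mul_lt_mul_of_pos_left hs.2 hk

theorem arcsin_div_joinFreq_mem {l x : ℝ} (hl : 0 < l) (hx : x ∈ Ioo (0 : ℝ) 1) :
    Real.arcsin x / joinFreq l ∈ Ioo 0 l := by
  have hk := joinFreq_pos hl
  refine ⟨div_pos (Real.arcsin_pos.2 hx.1) hk, ?_⟩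
  rw [div_lt_iff₀ hk, mul_comm, joinFreq_mul_self hl.ne']
  exact Real.arcsin_lt_pi_div_two.2 hx.2

theorem sqrt_mem_Ioo {y : ℝ} (hy : y ∈ Ioo (0 : ℝ) 1) : √y ∈ Ioo (0 : ℝ) 1 :=
  ⟨Real.sqrt_pos.2 hy.1, by rw [Real.sqrt_lt' one_pos]; simpa using hy.2⟩

theorem exists_mem_Ioo_sin_sq_eq {l y : ℝ} (hl : 0 < l) (hy : y ∈ Ioo (0 : ℝ) 1) :
    ∃ s ∈ Ioo 0 l, Real.sin (joinFreq l * s) ^ 2 = y := by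
  have h := sqrt_mem_Ioo hy
  refine ⟨_, arcsin_div_joinFreq_mem hl h, ?_⟩
  rw [mul_div_cancel₀ _ (joinFreq_pos hl).ne', Real.sin_arcsin (by linarith [h.1]) h.2.le,
    Real.sq_sqrt hy.1.le]

/-- The inverse of y = sin²(ks) is s = arcsin(√y)/k. As arcsin is odd and smooth near 0, the
function e(arcsin(x)/k) is even in x, and Whitney's theorem applies with y = x². -/
theorem exists_even_comp_arcsin {l δ : ℝ} (hl : 0 < l) (hδ : 0 < δ) {e : ℝ → ℝ}
    (he : ContDiffOn ℝ ∞ e (Ioo (-δ) δ)) (hee : ∀ t ∈ Ioo 0 δ, e (-t) = e t) :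
    ∃ g : ℝ → ℝ, ContDiff ℝ ∞ g ∧ g 0 = e 0 ∧ ∃ η > 0, ∀ y ∈ Ioo 0 η,
      Real.arcsin (√y) / joinFreq l ∈ Ioo 0 δ ∧ e (Real.arcsin (√y) / joinFreq l) = g y := by
  have hk := joinFreq_pos hl
  have hcont : Continuous fun x => Real.arcsin x / joinFreq l :=
    Real.continuous_arcsin.div_const _
  obtain ⟨η, hη, hηδ⟩ := Metric.continuousAt_iff.1 (hcont.continuousAt (x := 0)) δ hδ
  simp only [Real.arcsin_zero, zero_div, dist_zero_right, Real.norm_eq_abs] at hηδ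
  let η' := min η 1
  have hη' : 0 < η' := lt_min hη one_pos
  have hmaps : MapsTo (fun x => Real.arcsin x / joinFreq l) (Ioo (-η') η') (Ioo (-δ) δ) :=
    fun x hx => abs_lt.1 (hηδ (abs_lt.2 ⟨by linarith [hx.1, min_le_left η 1],
      by linarith [hx.2, min_le_left η 1]⟩))
  have hsm : ContDiffOn ℝ ∞ (fun x => Real.arcsin x / joinFreq l) (Ioo (-η') η') := by
    intro x hx
    have h1 : x ≠ -1 := by linarith [hx.1, min_le_right η 1] |> ne_of_gt
    have h2 : x ≠ 1 := by linarith [hx.2, min_le_right η 1] |> ne_of_lt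
    exact ((Real.contDiffAt_arcsin h1 h2).div_const _).contDiffWithinAt
  obtain ⟨g, hg, hgx⟩ := exists_contDiff_comp_sq_near_zero hη' (he.comp hsm hmaps) (by
    intro x hx
    simp only [Function.comp_apply, Real.arcsin_neg, neg_div]
    exact even_on_of_even_on_pos hee _ (hmaps hx))
  refine ⟨g, hg, ?_, (η' / 4) ^ 2, by positivity, fun y hy => ?_⟩
  · have := hgx 0 ⟨by linarith, by linarith⟩
    simpa using this.symm
  · have h1 : √y < η' / 4 := by rw [Real.sqrt_lt' (by positivity)]; exact hy.2
    have h0 : 0 < √y := Real.sqrt_pos.2 hy.1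
    have h2 := hgx (√y) ⟨by linarith, h1⟩
    rw [Real.sq_sqrt hy.1.le] at h2
    exact ⟨⟨div_pos (Real.arcsin_pos.2 h0) hk, (hmaps ⟨by linarith, by linarith⟩).2⟩, h2⟩

/-- A function on `(0, l)` that extends smoothly and evenly over both ends is a smooth function
of the squared radial coordinate of the join. -/
theorem exists_contDiff_comp_sin_sq {l δ : ℝ} (hl : 0 < l) (hδ : 0 < δ)
    {F e₀ e₁ : ℝ → ℝ} (hF : ContDiffOn ℝ ∞ F (Ioo 0 l))
    (he₀ : ContDiffOn ℝ ∞ e₀ (Ioo (-δ) δ)) (hee₀ : ∀ t ∈ Ioo 0 δ, e₀ (-t) = e₀ t)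
    (he₁ : ContDiffOn ℝ ∞ e₁ (Ioo (-δ) δ)) (hee₁ : ∀ t ∈ Ioo 0 δ, e₁ (-t) = e₁ t)
    (h₀ : ∀ t ∈ Ioo 0 δ, F t = e₀ t) (h₁ : ∀ t ∈ Ioo 0 δ, F (l - t) = e₁ t) :
    ∃ A : ℝ → ℝ, ContDiff ℝ ∞ A ∧ (∀ s ∈ Ioo 0 l, F s = A (Real.sin (joinFreq l * s) ^ 2)) ∧
      A 0 = e₀ 0 ∧ A 1 = e₁ 0 := by
  have hk := joinFreq_pos hl
  obtain ⟨g₀, hg₀, hg₀z, η₀, hη₀, hgy₀⟩ := exists_even_comp_arcsin hl hδ he₀ hee₀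
  obtain ⟨g₁, hg₁, hg₁z, η₁, hη₁, hgy₁⟩ := exists_even_comp_arcsin hl hδ he₁ hee₁
  -- The bound 1/2 keeps the neighbourhoods of y = 0 and y = 1 disjoint for the gluing.
  let η := min (min η₀ η₁) (1 / 2)
  have hη : 0 < η := lt_min (lt_min hη₀ hη₁) (by norm_num)
  have hηη₀ : η ≤ η₀ := (min_le_left _ _).trans (min_le_left _ _)
  have hηη₁ : η ≤ η₁ := (min_le_left _ _).trans (min_le_right _ _)
  have hη2 : η ≤ 1 / 2 := min_le_right _ _
  let f : ℝ → ℝ := fun y => F (Real.arcsin (√y) / joinFreq l)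
  have hf : ContDiffOn ℝ ∞ f (Ioo 0 1) := by
    intro y hy
    have hx := sqrt_mem_Ioo hy
    have h1 : ContDiffAt ℝ ∞ F (Real.arcsin (√y) / joinFreq l) :=
      hF.contDiffAt (isOpen_Ioo.mem_nhds (arcsin_div_joinFreq_mem hl hx))
    have h2 : ContDiffAt ℝ ∞ Real.arcsin (√y) :=
      Real.contDiffAt_arcsin (by linarith [hx.1]) hx.2.ne
    have h3 : ContDiffAt ℝ ∞ (fun y => Real.arcsin (√y) / joinFreq l) y :=
      (ContDiffAt.comp y h2 (Real.contDiffAt_sqrt hy.1.ne')).div_const _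
    exact (ContDiffAt.comp y h1 h3).contDiffWithinAt
  obtain ⟨A, hA, hAf, hA₀, hA₁⟩ := exists_contDiff_glue hη (by linarith) hf hg₀ hg₁
    (fun t ht => by
      obtain ⟨h2, h3⟩ := hgy₀ t ⟨ht.1, ht.2.trans_le hηη₀⟩
      simp only [f]
      rw [h₀ _ h2, h3])
    (fun t ht => by
      obtain ⟨h2, h3⟩ := hgy₁ t ⟨ht.1, ht.2.trans_le hηη₁⟩
      simp only [f]
      rw [arcsin_sqrt_eq_sub ⟨by linarith [ht.2], by linarith [ht.1]⟩, sub_sub_cancel, sub_div,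
        ← joinFreq_mul_self hl.ne', mul_div_cancel_left₀ _ hk.ne', h₁ _ h2, h3])
  refine ⟨A, hA, fun s hs => ?_, ?_, ?_⟩
  · have hks := joinFreq_mul_mem hs
    have hsin : Real.sin (joinFreq l * s) ∈ Ioo (0 : ℝ) 1 := by
      refine ⟨Real.sin_pos_of_pos_of_lt_pi hks.1 (by linarith [hks.2, Real.pi_pos]), ?_⟩
      rw [← Real.sin_pi_div_two]
      exact Real.sin_lt_sin_of_lt_of_le_pi_div_two (by linarith [hks.1, Real.pi_pos]) le_rfl hks.2
    rw [hAf ⟨pow_pos hsin.1 2, pow_lt_one₀ hsin.1.le hsin.2 two_ne_zero⟩]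
    simp only [f]
    rw [Real.sqrt_sq hsin.1.le, Real.arcsin_sin (by linarith [hks.1, Real.pi_pos]) hks.2.le,
      mul_div_cancel_left₀ _ hk.ne']
  · rw [hA₀ 0 hη, hg₀z]
  · have := hA₁ 0 hη
    rwa [sub_zero, hg₁z] at this

/-! ### Sufficiency: the coefficients A, C and D -/

theorem contDiff_warp {c l : ℝ} {Γ : ℝ → ℝ} (hΓ : ContDiff ℝ ∞ Γ) : ContDiff ℝ ∞ (warp c l Γ) := by
  have h := fun s => hasDerivAt_warp (c := c) (l := l) hΓ.continuous s
  rw [contDiff_infty_iff_deriv]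
  refine ⟨fun s => (h s).differentiableAt, ?_⟩
  rw [funext fun s => (h s).deriv]
  exact (contDiff_const.mul hΓ).neg

theorem warp_neg_eq {c l t : ℝ} {Γ : ℝ → ℝ} (hΓ : Continuous Γ) (ht : 0 ≤ t)
    (hodd : ∀ x ∈ Icc 0 t, Γ (-x) = -Γ x) : warp c l Γ (-t) = warp c l Γ t := by
  have hi : ∀ a b, IntervalIntegrable Γ volume a b := fun a b => hΓ.intervalIntegrable a b
  have h1 : ∫ x in (0 : ℝ)..t, Γ (-x) = ∫ x in -t..0, Γ x := by
    simp
  have h2 : ∫ x in (0 : ℝ)..t, Γ (-x) = -∫ x in (0 : ℝ)..t, Γ x := by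
    rw [← intervalIntegral.integral_neg]
    refine intervalIntegral.integral_congr fun x hx => ?_
    rw [uIcc_of_le ht] at hx
    exact hodd x hx
  have h3 := intervalIntegral.integral_add_adjacent_intervals (hi (-t) 0) (hi 0 l)
  have h4 := intervalIntegral.integral_add_adjacent_intervals (hi 0 t) (hi t l)
  unfold warp
  rw [← h3, ← h1, h2, ← h4]
  ring

theorem warp_add_eq {c l t : ℝ} {Γ : ℝ → ℝ} (ht : 0 ≤ t)
    (heven : ∀ x ∈ Icc 0 t, Γ (l + x) = Γ (l - x)) : warp c l Γ (l + t) = -warp c l Γ (l - t) := by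
  have h1 : ∫ x in (0 : ℝ)..t, Γ (l - x) = ∫ x in (l - t)..l, Γ x := by
    simp
  have h2 : ∫ x in (0 : ℝ)..t, Γ (l + x) = ∫ x in l..(l + t), Γ x := by
    simp
  have h3 : ∫ x in (0 : ℝ)..t, Γ (l + x) = ∫ x in (0 : ℝ)..t, Γ (l - x) :=
    intervalIntegral.integral_congr fun x hx => by
      rw [uIcc_of_le ht] at hx
      exact heven x hx
  unfold warp
  rw [intervalIntegral.integral_symm, ← h2, h3, h1]
  ring

/-- The expansions continue γ smoothly across both ends, so that its parities become identities of a
function on ℝ. -/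
theorem exists_smooth_representative {l c ε : ℝ} {γ a b : ℝ → ℝ} (hε : 0 < ε) (hεl : ε ≤ l)
    (hε1 : ε ≤ 1) (hγ : ContDiffOn ℝ ∞ γ (Ioo 0 l)) (ha : ContDiffOn ℝ ∞ a (Ioo (-ε) ε))
    (hb : ContDiffOn ℝ ∞ b (Ioo (-ε) ε))
    (hab : ∀ t ∈ Ioo 0 ε, γ t = t * (1 + t ^ 2 * a (t ^ 2)) ∧
      γ (l - t) = 1 / c + t ^ 2 * b (t ^ 2)) :
    ∃ Γ α : ℝ → ℝ, ContDiff ℝ ∞ Γ ∧ EqOn Γ γ (Ioo 0 l) ∧ ContDiff ℝ ∞ α ∧ α 0 = 1 ∧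
      (∀ t, α (-t) = α t) ∧ Γ l = 1 / c ∧ ∃ η > 0, η ≤ l ∧ (∀ t < η, Γ t = t * α t) ∧
        ∀ t ∈ Ioo (-η) η, Γ (l + t) = Γ (l - t) := by
  obtain ⟨a', ha', -, haa'⟩ := exists_contDiff_eq_near_zero hε ha
  obtain ⟨b', hb', -, hbb'⟩ := exists_contDiff_eq_near_zero hε hb
  -- This uses ε ≤ 1: then t < ε/4 forces t² < ε/4.
  have hsq : ∀ t ∈ Ioo 0 (ε / 4), t ^ 2 ∈ Ioo (-(ε / 4)) (ε / 4) := by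
    intro t ht
    have := ht.1
    have := ht.2
    constructor <;> nlinarith
  let α : ℝ → ℝ := fun t => 1 + t ^ 2 * a' (t ^ 2)
  let β : ℝ → ℝ := fun t => 1 / c + t ^ 2 * b' (t ^ 2)
  have hα : ContDiff ℝ ∞ α := by fun_prop
  have hβ : ContDiff ℝ ∞ β := by fun_prop
  obtain ⟨Γ, hΓ, hΓγ, hΓ₀, hΓ₁⟩ := exists_contDiff_glue (η := ε / 4) (by positivity)
    (by linarith) hγ (contDiff_id.mul hα) hβ
    (fun t ht => by
      rw [(hab t ⟨ht.1, by linarith [ht.2]⟩).1, haa' _ (hsq t ht)]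
      rfl)
    (fun t ht => by
      rw [(hab t ⟨ht.1, by linarith [ht.2]⟩).2, hbb' _ (hsq t ht)])
  refine ⟨Γ, α, hΓ, hΓγ, hα, by simp [α], fun t => by simp [α], ?_, ε / 4, by positivity,
    by linarith, hΓ₀, fun t ht => ?_⟩
  · have := hΓ₁ 0 (by positivity)
    simpa [β] using this
  · have h := hΓ₁ (-t) (by linarith [ht.1])
    rw [sub_neg_eq_add] at h
    rw [h, hΓ₁ t ht.2]
    simp [β]

/-- A and C are γ²/sin² and λ²/cos² as functions of y. Slope 1 of γ at 0 gives A(0) = 1/k², and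
slope -cγ(l) = -1 of λ at l gives C(1) = 1/k²; these are the two conditions for the remainder to be
divisible by y(1 - y). -/
theorem exists_metric_profiles {l c ε : ℝ} {γ a b : ℝ → ℝ} (hl : 0 < l) (hc : 0 < c) (hε : 0 < ε)
    (hεl : ε ≤ l) (hε1 : ε ≤ 1) (hγ : ContDiffOn ℝ ∞ γ (Ioo 0 l)) (hpos : ∀ s ∈ Ioo 0 l, 0 < γ s)
    (ha : ContDiffOn ℝ ∞ a (Ioo (-ε) ε)) (hb : ContDiffOn ℝ ∞ b (Ioo (-ε) ε))
    (hab : ∀ t ∈ Ioo 0 ε, γ t = t * (1 + t ^ 2 * a (t ^ 2)) ∧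
      γ (l - t) = 1 / c + t ^ 2 * b (t ^ 2)) :
    ∃ A C D : ℝ → ℝ, ContDiff ℝ ∞ A ∧ ContDiff ℝ ∞ C ∧ ContDiff ℝ ∞ D ∧
      (∀ s ∈ Ioo 0 l, γ s ^ 2 =
        Real.sin (joinFreq l * s) ^ 2 * A (Real.sin (joinFreq l * s) ^ 2)) ∧
      (∀ s ∈ Ioo 0 l, warp c l γ s ^ 2 =
        Real.cos (joinFreq l * s) ^ 2 * C (Real.sin (joinFreq l * s) ^ 2)) ∧
      (∀ y ∈ Icc (0 : ℝ) 1, 0 < A y) ∧ (∀ y ∈ Icc (0 : ℝ) 1, 0 < C y) ∧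
      ∀ y, 1 - joinFreq l ^ 2 * (1 - y) * A y - joinFreq l ^ 2 * y * C y =
        joinFreq l ^ 2 * y * (1 - y) * D y := by
  obtain ⟨Γ, α, hΓ, hΓγ, hα, hα0, hαe, hΓl, η, hη, hηl, hΓα, hΓe⟩ :=
    exists_smooth_representative hε hεl hε1 hγ ha hb hab
  have hk := joinFreq_pos hl
  have hkl : joinFreq l * l = Real.pi / 2 := joinFreq_mul_self hl.ne'
  obtain ⟨σ, hσ, hσe, hσ0, hσs⟩ := exists_sin_eq_mul (joinFreq l)
  set k := joinFreq l with hkdef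
  have hΓpos : ∀ s ∈ Ioo 0 l, 0 < Γ s := fun s hs => by rw [hΓγ hs]; exact hpos s hs
  -- the second warping function
  let Λ : ℝ → ℝ := warp c l Γ
  have hΛ : ContDiff ℝ ∞ Λ := contDiff_warp hΓ
  have hΛγ : ∀ s ∈ Ioo 0 l, warp c l γ s = Λ s := fun s hs => warp_eq_of_eqOn hs hΓγ.symm
  have hΛpos : ∀ s ∈ Ico 0 l, 0 < Λ s := fun s hs =>
    mul_pos hc (intervalIntegral.intervalIntegral_pos_of_pos_on (hΓ.continuous.intervalIntegrable _ _)
      (fun x hx => hΓpos x ⟨hs.1.trans_lt hx.1, hx.2⟩) hs.2)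
  have hΛe : ∀ t ∈ Ioo 0 η, Λ (-t) = Λ t := fun t ht =>
    warp_neg_eq hΓ.continuous ht.1.le fun x hx => by
      rw [hΓα x (by linarith [hx.2, ht.2]), hΓα (-x) (by linarith [hx.1]), hαe]
      ring
  have hΛo : ∀ t ∈ Ioo 0 η, Λ (l + t) = -Λ (l - t) := fun t ht =>
    warp_add_eq ht.1.le fun x hx => hΓe x ⟨by linarith [hx.1], by linarith [hx.2, ht.2]⟩
  have hΛl : Λ l = 0 := by simp [Λ, warp]
  obtain ⟨χ, hχ, hΛχ⟩ := exists_contDiff_eq_add_mul (f := fun t => Λ (l - t))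
    (hΛ.comp (contDiff_const.sub contDiff_id))
  simp only [sub_zero, hΛl, zero_add] at hΛχ
  have hχ0 : χ 0 = 1 := by
    have h1 := hasDerivAt_zero_of_eq_add_mul (y := 0) hχ fun t => (hΛχ t).trans (zero_add _).symm
    have h2 : HasDerivAt Λ (-(c * Γ l)) (l - 0) := by
      rw [sub_zero]; exact hasDerivAt_warp hΓ.continuous l
    have h3 := h2.comp (0 : ℝ) ((hasDerivAt_id (0 : ℝ)).const_sub l)
    rw [hΓl, mul_one_div_cancel hc.ne'] at h3
    have := h1.unique h3
    simpa using this
  have hχe : ∀ t ∈ Ioo 0 η, χ (-t) = χ t := by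
    intro t ht
    have h1 := hΛχ (-t)
    rw [sub_neg_eq_add, hΛo t ht, hΛχ t] at h1
    exact mul_left_cancel₀ ht.1.ne' (by linarith)
  -- neighbourhoods of the ends
  obtain ⟨δ₀, hδ₀, hσpos⟩ := exists_pos_near hσ.continuous (x := 0) (hσ0 ▸ hk)
  simp only [zero_add] at hσpos
  let δ := min δ₀ η
  have hδ : 0 < δ := lt_min hδ₀ hη
  have hδδ₀ : δ ≤ δ₀ := min_le_left _ _
  have hδη : δ ≤ η := min_le_right _ _
  have hσne : ∀ t ∈ Ioo (-δ) δ, σ t ^ 2 ≠ 0 := fun t ht =>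
    (pow_pos (hσpos t ⟨by linarith [ht.1], by linarith [ht.2]⟩) 2).ne'
  have hcos : ∀ t ∈ Ioo (-l) l, 0 < Real.cos (k * t) := by
    intro t ht
    refine Real.cos_pos_of_mem_Ioo ⟨?_, ?_⟩
    · have := mul_lt_mul_of_pos_left ht.1 hk
      rw [mul_neg, hkl] at this
      exact this
    · have := mul_lt_mul_of_pos_left ht.2 hk
      rwa [hkl] at this
  have hcosne : ∀ t ∈ Ioo (-δ) δ, Real.cos (k * t) ^ 2 ≠ 0 := fun t ht =>
    (pow_pos (hcos t ⟨by linarith [ht.1], by linarith [ht.2]⟩) 2).ne'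
  have hsin : ∀ s ∈ Ioo 0 l, 0 < Real.sin (k * s) := fun s hs =>
    Real.sin_pos_of_pos_of_lt_pi (joinFreq_mul_mem hs).1
      (by linarith [(joinFreq_mul_mem hs).2, Real.pi_pos])
  have hsinl : ∀ t, Real.sin (k * (l - t)) = Real.cos (k * t) := fun t => by
    rw [mul_sub, hkl, Real.sin_pi_div_two_sub]
  have hcosl : ∀ t, Real.cos (k * (l - t)) = Real.sin (k * t) := fun t => by
    rw [mul_sub, hkl, Real.cos_pi_div_two_sub]
  have hcosk : ContDiff ℝ ∞ fun t => Real.cos (k * t) ^ 2 := by fun_prop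
  have hsink : ContDiff ℝ ∞ fun t => Real.sin (k * t) ^ 2 := by fun_prop
  have hrefl : ContDiff ℝ ∞ fun t => Γ (l - t) := hΓ.comp (contDiff_const.sub contDiff_id)
  -- the coefficient of the first factor
  obtain ⟨A, hA, hAs, hA0, hA1⟩ := exists_contDiff_comp_sin_sq hl hδ
    (F := fun s => Γ s ^ 2 / Real.sin (k * s) ^ 2) (e₀ := fun t => α t ^ 2 / σ t ^ 2)
    (e₁ := fun t => Γ (l - t) ^ 2 / Real.cos (k * t) ^ 2)
    ((hΓ.pow 2).contDiffOn.div hsink.contDiffOn fun s hs => (pow_pos (hsin s hs) 2).ne')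
    ((hα.pow 2).contDiffOn.div (hσ.pow 2).contDiffOn hσne)
    (fun t _ => by simp only [hαe, hσe])
    ((hrefl.pow 2).contDiffOn.div hcosk.contDiffOn hcosne)
    (fun t ht => by
      simp only [sub_neg_eq_add, mul_neg, Real.cos_neg]
      rw [hΓe t ⟨by linarith [ht.1], by linarith [ht.2]⟩])
    (fun t ht => by
      simp only [hσs, hΓα t (by linarith [ht.2])]
      rw [mul_pow, mul_pow, mul_div_mul_left _ _ (pow_ne_zero 2 ht.1.ne')])
    (fun t _ => by simp only [hsinl])
  -- the coefficient of the second factor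
  obtain ⟨C, hC, hCs, hC0, hC1⟩ := exists_contDiff_comp_sin_sq hl hδ
    (F := fun s => Λ s ^ 2 / Real.cos (k * s) ^ 2)
    (e₀ := fun s => Λ s ^ 2 / Real.cos (k * s) ^ 2) (e₁ := fun t => χ t ^ 2 / σ t ^ 2)
    ((hΛ.pow 2).contDiffOn.div hcosk.contDiffOn fun s hs =>
      (pow_pos (hcos s ⟨by linarith [hs.1], hs.2⟩) 2).ne')
    ((hΛ.pow 2).contDiffOn.div hcosk.contDiffOn hcosne)
    (fun t ht => by
      simp only [mul_neg, Real.cos_neg, hΛe t ⟨ht.1, by linarith [ht.2]⟩])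
    ((hχ.pow 2).contDiffOn.div (hσ.pow 2).contDiffOn hσne)
    (fun t ht => by simp only [hσe, hχe t ⟨ht.1, by linarith [ht.2]⟩])
    (fun t _ => rfl)
    (fun t ht => by
      simp only [hcosl, hσs, hΛχ]
      rw [mul_pow, mul_pow, mul_div_mul_left _ _ (pow_ne_zero 2 ht.1.ne')])
  simp only [hα0, hσ0, sub_zero, mul_zero, Real.cos_zero, hΓl, hχ0, one_pow, div_one] at hA0 hA1 hC0 hC1
  have hAs' : ∀ s ∈ Ioo 0 l, γ s ^ 2 = Real.sin (k * s) ^ 2 * A (Real.sin (k * s) ^ 2) := by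
    intro s hs
    rw [← hAs s hs, ← hΓγ hs, mul_div_cancel₀ _ (pow_pos (hsin s hs) 2).ne']
  have hCs' : ∀ s ∈ Ioo 0 l, warp c l γ s ^ 2 =
      Real.cos (k * s) ^ 2 * C (Real.sin (k * s) ^ 2) := by
    intro s hs
    rw [← hCs s hs, hΛγ s hs,
      mul_div_cancel₀ _ (pow_pos (hcos s ⟨by linarith [hs.1], hs.2⟩) 2).ne']
  -- Every y in [0, 1] is an end point or sin²(ks) for some s in (0, l).
  have hcover : ∀ P : ℝ → Prop, P 0 → P 1 → (∀ s ∈ Ioo 0 l, P (Real.sin (k * s) ^ 2)) →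
      ∀ y ∈ Icc (0 : ℝ) 1, P y := by
    intro P h0 h1 h y hy
    rcases hy.1.eq_or_lt with rfl | hy0
    · exact h0
    · rcases hy.2.eq_or_lt with rfl | hy1
      · exact h1
      · obtain ⟨s, hs, rfl⟩ := exists_mem_Ioo_sin_sq_eq hl ⟨hy0, hy1⟩
        exact h s hs
  have hApos : ∀ y ∈ Icc (0 : ℝ) 1, 0 < A y := hcover _ (by rw [hA0]; positivity)
    (by rw [hA1]; positivity) fun s hs => by
      rw [← hAs s hs]
      exact div_pos (pow_pos (hΓpos s hs) 2) (pow_pos (hsin s hs) 2)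
  have hCpos : ∀ y ∈ Icc (0 : ℝ) 1, 0 < C y := hcover _
    (by rw [hC0]; exact pow_pos (hΛpos 0 ⟨le_rfl, hl⟩) 2)
    (by rw [hC1]; positivity) fun s hs => by
      rw [← hCs s hs]
      exact div_pos (pow_pos (hΛpos s ⟨hs.1.le, hs.2⟩) 2)
        (pow_pos (hcos s ⟨by linarith [hs.1], hs.2⟩) 2)
  -- the mixed coefficient
  let N : ℝ → ℝ := fun y => 1 - k ^ 2 * (1 - y) * A y - k ^ 2 * y * C y
  have hN : ContDiff ℝ ∞ N := by fun_prop
  have hN0 : N 0 = 0 := by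
    simp only [N, hA0]
    field_simp
    ring
  have hN1 : N 1 = 0 := by
    simp only [N, hC1]
    field_simp
    ring
  obtain ⟨M, hM, hNM⟩ := exists_contDiff_eq_add_mul hN
  have hM1 : M 1 = 0 := by
    have := hNM 1
    rw [hN0, hN1] at this
    linarith
  obtain ⟨D, hD, hMD⟩ := exists_contDiff_eq_add_mul (f := fun t => M (1 - t))
    (hM.comp (contDiff_const.sub contDiff_id))
  simp only [sub_zero, hM1, zero_add] at hMD
  refine ⟨A, C, fun y => D (1 - y) / k ^ 2, hA, hC,
    (hD.comp (contDiff_const.sub contDiff_id)).div_const _, hAs', hCs', hApos, hCpos, fun y => ?_⟩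
  have h1 := hMD (1 - y)
  rw [sub_sub_cancel] at h1
  have h2 : N y = y * ((1 - y) * D (1 - y)) := by rw [hNM y, hN0, h1, zero_add]
  change N y = _
  rw [h2]
  field_simp

/-! ### Sufficiency: the ambient bilinear form -/

/-- The projection of the ambient space to its first factor. -/
noncomputable def joinFst (m : ℕ) : JoinSpace m →L[ℝ] Euc (m + 1) :=
  (ContinuousLinearMap.fst ℝ _ _).comp
    (WithLp.prodContinuousLinearEquiv 2 ℝ (Euc (m + 1)) (Euc 2)).toContinuousLinearMap

/-- The projection of the ambient space to its second factor. -/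
noncomputable def joinSnd (m : ℕ) : JoinSpace m →L[ℝ] Euc 2 :=
  (ContinuousLinearMap.snd ℝ _ _).comp
    (WithLp.prodContinuousLinearEquiv 2 ℝ (Euc (m + 1)) (Euc 2)).toContinuousLinearMap

/-- The pullback of the inner product by a linear map. -/
noncomputable def pullbackInner {E F : Type*} [NormedAddCommGroup E] [NormedSpace ℝ E]
    [NormedAddCommGroup F] [InnerProductSpace ℝ F] (L : E →L[ℝ] F) : E →L[ℝ] E →L[ℝ] ℝ :=
  ContinuousLinearMap.bilinearComp (σ₁₃ := RingHom.id ℝ) (innerSL ℝ) L L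

/-- The bilinear form `A |dX|² + C |dΘ|² + D (X · dX)²` with `X = P z`, `Θ = Q z` and coefficients
depending on `|X|²`. -/
noncomputable def radialForm {E F F' : Type*} [NormedAddCommGroup E] [NormedSpace ℝ E]
    [NormedAddCommGroup F] [InnerProductSpace ℝ F] [NormedAddCommGroup F'] [InnerProductSpace ℝ F']
    (P : E →L[ℝ] F) (Q : E →L[ℝ] F') (A C D : ℝ → ℝ) (z : E) : E →L[ℝ] E →L[ℝ] ℝ :=
  A (‖P z‖ ^ 2) • pullbackInner P + C (‖P z‖ ^ 2) • pullbackInner Q +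
    D (‖P z‖ ^ 2) • ((innerSL ℝ (P z)).comp P).smulRight ((innerSL ℝ (P z)).comp P)

theorem contDiff_smul_real {E W : Type*} [NormedAddCommGroup E] [NormedSpace ℝ E]
    [NormedAddCommGroup W] [NormedSpace ℝ W] {f : E → ℝ} {g : E → W} (hf : ContDiff ℝ ∞ f)
    (hg : ContDiff ℝ ∞ g) : ContDiff ℝ ∞ fun z => f z • g z := hf.smul hg

theorem contDiff_radialForm {E F F' : Type*} [NormedAddCommGroup E] [NormedSpace ℝ E]
    [NormedAddCommGroup F] [InnerProductSpace ℝ F] [NormedAddCommGroup F'] [InnerProductSpace ℝ F']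
    (P : E →L[ℝ] F) (Q : E →L[ℝ] F') {A C D : ℝ → ℝ} (hA : ContDiff ℝ ∞ A)
    (hC : ContDiff ℝ ∞ C) (hD : ContDiff ℝ ∞ D) : ContDiff ℝ ∞ (radialForm P Q A C D) := by
  have hr : ContDiff ℝ ∞ fun z : E => ‖P z‖ ^ 2 := P.contDiff.norm_sq ℝ
  have hξ : ContDiff ℝ ∞ fun z : E => (innerSL ℝ (P z)).comp P :=
    ((innerSL ℝ).contDiff.comp P.contDiff).clm_comp contDiff_const
  exact ((contDiff_smul_real (hA.comp hr) contDiff_const).add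
    (contDiff_smul_real (hC.comp hr) contDiff_const)).add
    (contDiff_smul_real (hD.comp hr) (hξ.smulRight hξ))

/-- The form `A |dX|² + C |dΘ|² + D (X · dX)²` at `(X, Θ)` in the ambient space. -/
noncomputable def joinForm {m : ℕ} (A C D : ℝ → ℝ) (z : JoinSpace m) :
    JoinSpace m →L[ℝ] JoinSpace m →L[ℝ] ℝ :=
  radialForm (joinFst m) (joinSnd m) A C D z

theorem joinForm_apply {m : ℕ} (A C D : ℝ → ℝ) (z u v : JoinSpace m) :
    joinForm A C D z u v = A (‖z.fst‖ ^ 2) * inner ℝ u.fst v.fst +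
      C (‖z.fst‖ ^ 2) * inner ℝ u.snd v.snd +
      D (‖z.fst‖ ^ 2) * (inner ℝ z.fst u.fst * inner ℝ z.fst v.fst) := rfl

theorem contDiff_joinForm {m : ℕ} {A C D : ℝ → ℝ} (hA : ContDiff ℝ ∞ A) (hC : ContDiff ℝ ∞ C)
    (hD : ContDiff ℝ ∞ D) : ContDiff ℝ ∞ (joinForm (m := m) A C D) :=
  contDiff_radialForm _ _ hA hC hD

/-- D may be negative. Tangency gives τ = X·dX = -Θ·dΘ, so Cauchy–Schwarz bounds τ² by both y|dX|²
and (1-y)|dΘ|². Eliminating D then leaves two nonnegative terms plus τ². -/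
theorem joinForm_pos {m : ℕ} {A C D : ℝ → ℝ} {k : ℝ} (hA : ∀ y ∈ Icc (0 : ℝ) 1, 0 < A y)
    (hC : ∀ y ∈ Icc (0 : ℝ) 1, 0 < C y)
    (hD : ∀ y, 1 - k ^ 2 * (1 - y) * A y - k ^ 2 * y * C y = k ^ 2 * y * (1 - y) * D y)
    {z u : JoinSpace m} (hz : ‖z‖ = 1) (hu : inner ℝ z u = 0) (hu0 : u ≠ 0) :
    0 < joinForm A C D z u u := by
  rw [joinForm_apply, real_inner_self_eq_norm_sq, real_inner_self_eq_norm_sq]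
  have hz2 : ‖z.fst‖ ^ 2 + ‖z.snd‖ ^ 2 = 1 := by
    rw [← WithLp.prod_norm_sq_eq_of_L2, hz, one_pow]
  have hu2 : 0 < ‖u.fst‖ ^ 2 + ‖u.snd‖ ^ 2 := by
    rw [← WithLp.prod_norm_sq_eq_of_L2]
    exact pow_pos (norm_pos_iff.2 hu0) 2
  have hin : inner ℝ z.fst u.fst + inner ℝ z.snd u.snd = 0 := by
    exact hu
  have hcs₁ : (inner ℝ z.fst u.fst : ℝ) ^ 2 ≤ ‖z.fst‖ ^ 2 * ‖u.fst‖ ^ 2 := by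
    rw [← mul_pow, ← sq_abs (inner ℝ z.fst u.fst : ℝ)]
    exact pow_le_pow_left₀ (abs_nonneg _) (abs_real_inner_le_norm _ _) 2
  have hcs₂ : (inner ℝ z.fst u.fst : ℝ) ^ 2 ≤ ‖z.snd‖ ^ 2 * ‖u.snd‖ ^ 2 := by
    rw [eq_neg_of_add_eq_zero_left hin, neg_sq, ← mul_pow, ← sq_abs (inner ℝ z.snd u.snd : ℝ)]
    exact pow_le_pow_left₀ (abs_nonneg _) (abs_real_inner_le_norm _ _) 2
  have hy : ‖z.fst‖ ^ 2 ∈ Icc (0 : ℝ) 1 := ⟨sq_nonneg _, by linarith [sq_nonneg ‖z.snd‖]⟩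
  have hp := sq_nonneg ‖u.fst‖
  have hr := sq_nonneg ‖u.snd‖
  have hz2' : ‖z.snd‖ ^ 2 = 1 - ‖z.fst‖ ^ 2 := by linarith
  rw [hz2'] at hcs₂
  have hAy := hA _ hy
  have hCy := hC _ hy
  have hDy := hD (‖z.fst‖ ^ 2)
  generalize (inner ℝ z.fst u.fst : ℝ) = τ at *
  generalize ‖z.fst‖ ^ 2 = y at *
  generalize ‖u.fst‖ ^ 2 = p at *
  generalize ‖u.snd‖ ^ 2 = r at *
  rcases eq_or_ne τ 0 with rfl | hτ
  · have : 0 < A y * p + C y * r := by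
      rcases hp.eq_or_lt with rfl | hp'
      · have := mul_pos hCy (by linarith : 0 < r)
        linarith
      · have := mul_pos hAy hp'
        have := mul_nonneg hCy.le hr
        linarith
    linarith
  · have hτ2 : 0 < τ ^ 2 := by positivity
    -- At y = 0 or y = 1 one of the Cauchy–Schwarz bounds would force τ = 0.
    have hy0 : 0 < y := by
      rcases hy.1.eq_or_lt with rfl | h
      · linarith
      · exact h
    have hy1 : 0 < 1 - y := by
      rcases hy.2.eq_or_lt with rfl | h
      · linarith
      · linarith
    have hk0 : 0 ≤ k ^ 2 * (y * (1 - y)) := by positivity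
    have key : k ^ 2 * (y * (1 - y)) * (A y * p + C y * r + D y * (τ * τ)) =
        k ^ 2 * (1 - y) * A y * (y * p - τ ^ 2) + k ^ 2 * y * C y * ((1 - y) * r - τ ^ 2) +
          τ ^ 2 := by
      linear_combination (-τ ^ 2) * hDy
    have h1 : 0 ≤ k ^ 2 * (1 - y) * A y * (y * p - τ ^ 2) :=
      mul_nonneg (by positivity) (by linarith)
    have h2 : 0 ≤ k ^ 2 * y * C y * ((1 - y) * r - τ ^ 2) :=
      mul_nonneg (by positivity) (by linarith)
    exact pos_of_mul_pos_right (key ▸ (by linarith)) hk0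

/-- Cross terms vanish because x and θ are orthogonal to their tangent spaces, and the coefficient
of ds² is k²(1-y)A + k²yC + k²y(1-y)D, which is 1 by the choice of D. -/
theorem joinForm_mfderiv_joinMap {m : ℕ} {l : ℝ} {A C D γ Λ : ℝ → ℝ}
    (hD : ∀ y, 1 - joinFreq l ^ 2 * (1 - y) * A y - joinFreq l ^ 2 * y * C y =
      joinFreq l ^ 2 * y * (1 - y) * D y) (p : ℝ × Sph m × Sph 1)
    (hγ : γ p.1 ^ 2 = Real.sin (joinFreq l * p.1) ^ 2 * A (Real.sin (joinFreq l * p.1) ^ 2))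
    (hΛ : Λ p.1 ^ 2 = Real.cos (joinFreq l * p.1) ^ 2 * C (Real.sin (joinFreq l * p.1) ^ 2))
    (u v : TangentSpace (cylModel m) p) :
    joinForm A C D (joinMap l p)
      (sphereIncl (joinMap l p) (mfderiv (cylModel m) (𝓡 (m + 2)) (joinMap l) p u))
      (sphereIncl (joinMap l p) (mfderiv (cylModel m) (𝓡 (m + 2)) (joinMap l) p v)) =
      joinMetric γ Λ p u v := by
  rw [sphereIncl_mfderiv_joinMap, sphereIncl_mfderiv_joinMap, joinForm_apply, joinMap_coe]
  have hx : ‖(p.2.1 : Euc (m + 1))‖ = 1 := norm_eq_of_mem_sphere _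
  have hθ : ‖(p.2.2 : Euc 2)‖ = 1 := norm_eq_of_mem_sphere _
  have hxu : inner ℝ (p.2.1 : Euc (m + 1)) (sphereIncl p.2.1 u.2.1) = 0 := inner_sphereIncl _ _
  have hxv : inner ℝ (p.2.1 : Euc (m + 1)) (sphereIncl p.2.1 v.2.1) = 0 := inner_sphereIncl _ _
  have hθu : inner ℝ (p.2.2 : Euc 2) (sphereIncl p.2.2 u.2.2) = 0 := inner_sphereIncl _ _
  have hθv : inner ℝ (p.2.2 : Euc 2) (sphereIncl p.2.2 v.2.2) = 0 := inner_sphereIncl _ _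
  have hxu' := (real_inner_comm (p.2.1 : Euc (m + 1)) (sphereIncl p.2.1 u.2.1)).trans hxu
  have hθu' := (real_inner_comm (p.2.2 : Euc 2) (sphereIncl p.2.2 u.2.2)).trans hθu
  have h1 : joinMetric γ Λ p u v = (u.1 : ℝ) * (v.1 : ℝ) +
      γ p.1 ^ 2 * inner ℝ (sphereIncl p.2.1 u.2.1) (sphereIncl p.2.1 v.2.1) +
      Λ p.1 ^ 2 * inner ℝ (sphereIncl p.2.2 u.2.2) (sphereIncl p.2.2 v.2.2) := rfl
  rw [h1, hγ, hΛ]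
  have hcos := Real.cos_sq' (joinFreq l * p.1)
  have hDy := hD (Real.sin (joinFreq l * p.1) ^ 2)
  have hnorm : ‖Real.sin (joinFreq l * p.1) • (p.2.1 : Euc (m + 1))‖ ^ 2 =
      Real.sin (joinFreq l * p.1) ^ 2 := by
    rw [norm_smul, hx, mul_one, Real.norm_eq_abs, sq_abs]
  simp only [WithLp.toLp_fst, WithLp.toLp_snd, hnorm, inner_add_left, inner_add_right,
    inner_smul_left, inner_smul_right, real_inner_self_eq_norm_sq, hx, hθ, hxu, hxv, hθv,
    hxu', hθu', conj_trivial]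
  linear_combination (joinFreq l ^ 2 * (u.1 : ℝ) * (v.1 : ℝ) * (A (Real.sin (joinFreq l * p.1) ^ 2) +
    Real.sin (joinFreq l * p.1) ^ 2 * D (Real.sin (joinFreq l * p.1) ^ 2))) * hcos -
    (u.1 : ℝ) * (v.1 : ℝ) * hDy

theorem extendsSmoothly_of_profiles {m : ℕ} {l : ℝ} {A C D γ Λ : ℝ → ℝ}
    (hA : ContDiff ℝ ∞ A) (hC : ContDiff ℝ ∞ C) (hD : ContDiff ℝ ∞ D)
    (hγ : ∀ s ∈ Ioo 0 l, γ s ^ 2 =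
        Real.sin (joinFreq l * s) ^ 2 * A (Real.sin (joinFreq l * s) ^ 2))
    (hΛ : ∀ s ∈ Ioo 0 l, Λ s ^ 2 =
        Real.cos (joinFreq l * s) ^ 2 * C (Real.sin (joinFreq l * s) ^ 2))
    (hApos : ∀ y ∈ Icc (0 : ℝ) 1, 0 < A y) (hCpos : ∀ y ∈ Icc (0 : ℝ) 1, 0 < C y)
    (hACD : ∀ y, 1 - joinFreq l ^ 2 * (1 - y) * A y - joinFreq l ^ 2 * y * C y =
      joinFreq l ^ 2 * y * (1 - y) * D y) : ExtendsSmoothly m l γ Λ := by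
  obtain ⟨G, hG⟩ := exists_riemannianMetric_sphere (E := JoinSpace m) (n := m + 2)
    (B := fun q => joinForm A C D (q : JoinSpace m))
    ((contDiff_joinForm hA hC hD).contMDiff.comp contMDiff_coe_sphere)
    (fun q u v => by
      rw [joinForm_apply, joinForm_apply, real_inner_comm v.fst u.fst,
        real_inner_comm v.snd u.snd]
      ring)
    (fun q u hu hu0 => joinForm_pos hApos hCpos hACD (norm_eq_of_mem_sphere q) hu hu0)
  exact ⟨G, fun p hp u v => (hG _ _ _).trans
    (joinForm_mfderiv_joinMap hACD p (hγ _ hp) (hΛ _ hp) u v)⟩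

end RiemannianJoin

theorem mainTheorem11 (m : ℕ) (hm : 1 ≤ m) (l c L : ℝ) (hl : 0 < l) (hc : 0 < c)
    (γ : ℝ → ℝ) (hγ : ContDiffOn ℝ ∞ γ (Ioo 0 l)) (hpos : ∀ s ∈ Ioo 0 l, 0 < γ s)
    (h0 : Tendsto γ (𝓝[>] 0) (𝓝 0)) (hL : 0 < L) (h1 : Tendsto γ (𝓝[<] l) (𝓝 L)) :
    RiemannianJoin.ExtendsSmoothly m l γ (RiemannianJoin.warp c l γ) ↔
      ∃ ε : ℝ, 0 < ε ∧ ε ≤ l ∧ ε ≤ 1 ∧ ∃ a b : ℝ → ℝ,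
        ContDiffOn ℝ ∞ a (Ioo (-ε) ε) ∧ ContDiffOn ℝ ∞ b (Ioo (-ε) ε) ∧
        ∀ t ∈ Ioo 0 ε, γ t = t * (1 + t ^ 2 * a (t ^ 2)) ∧
          γ (l - t) = 1 / c + t ^ 2 * b (t ^ 2) := by
  constructor
  · intro hext
    obtain ⟨H, K, hH, hK, hγH, hΛK, hH0, hHl, hHz, hKl⟩ :=
      RiemannianJoin.exists_smooth_extension_data hm hl hext
    exact RiemannianJoin.exists_even_expansions_of_extension_data hl hc hpos hL h1 hH hK hγH hΛK
      hH0 hHl hHz hKl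
  · rintro ⟨ε, hε, hεl, hε1, a, b, ha, hb, hab⟩
    obtain ⟨A, C, D, hA, hC, hD, hγA, hΛC, hApos, hCpos, hACD⟩ :=
      RiemannianJoin.exists_metric_profiles hl hc hε hεl hε1 hγ hpos ha hb hab
    exact RiemannianJoin.extendsSmoothly_of_profiles hA hC hD hγA hΛC hApos hCpos hACD
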